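/- Let $K$ be a field, let $n\ge 5$, and let $R=K[x_1,\ldots,x_n]$ with its standard grading. Let $I\subseteq R$ be a defect two quadratic ideal, that is, an ideal $I=(f_1,\ldots,f_n,g,h)$ minimally generated by $n+2$ quadratic forms $f_1,\ldots,f_n,g,h$ such that $f_1,\ldots,f_n$ is a regular sequence. Write $I_d$ for the $K$-vector space of forms of degree $d$ in $I$. Then $$\dim_K I_3\ \ge\ n^2+2n-5 .$$ Moreover, $\mathrm{EGH}_{(2,\ldots,2),n}(2)$ holds for $I$: there is a lex-plus-powers ideal $\mathcal L=(x_1^2,\ldots,x_n^2)+J\subseteq R$, where $J$ is a lexicographic ideal, such that $$\dim_K I_2=\dim_K \mathcal L_2\qquad\text{and}\qquad \dim_K I_3=\dim_K\mathcal L_3 .$$ Here a monomial ideal $J\subseteq R$ is called lexicographic if for every $d$ the space $J_d$ is spanned over $K$ by an initial segment (from the greatest monomial downwards, possibly empty) of the monomials of degree $d$ in the lexicographic order with $x_1>\cdots>x_n$. -/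

import Mathlib

noncomputable section

namespace EGH

open MvPolynomial

variable {K : Type*} [Field K] {n : ℕ}

/-- The degree `d` component `I_d = I ∩ R_d` of an ideal `I` of `R = K[x_1, …, x_n]`,
as a `K`-subspace of `R`. -/
def component (I : Ideal (MvPolynomial (Fin n) K)) (d : ℕ) :
    Submodule K (MvPolynomial (Fin n) K) :=
  I.restrictScalars K ⊓ homogeneousSubmodule (Fin n) K d

/-- The Hilbert function `dim_K I_d` of an ideal `I`. The space `R_d` is finite-dimensional,
so `Module.finrank` is the true dimension. -/
def hilbert (I : Ideal (MvPolynomial (Fin n) K)) (d : ℕ) : ℕ :=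
  Module.finrank K (component I d)

/-- The family `v` is a minimal system of generators of `I`: it generates `I`, and no family
obtained by leaving out one member does. -/
def IsMinimalGenerators {ι : Type*} (v : ι → MvPolynomial (Fin n) K)
    (I : Ideal (MvPolynomial (Fin n) K)) : Prop :=
  Ideal.span (Set.range v) = I ∧ ∀ i, Ideal.span (v '' {j | j ≠ i}) ≠ I

/-- `I` is a defect `δ` quadratic ideal: it is minimally generated by `n + δ` quadratic forms
`f_1, …, f_n, g_1, …, g_δ`, where `f_1, …, f_n` is a regular sequence. -/
def IsDefectQuadraticIdeal (δ : ℕ) (I : Ideal (MvPolynomial (Fin n) K)) : Prop :=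
  ∃ (f : Fin n → MvPolynomial (Fin n) K) (g : Fin δ → MvPolynomial (Fin n) K),
    (∀ i, (f i).IsHomogeneous 2) ∧ (∀ j, (g j).IsHomogeneous 2) ∧
    RingTheory.Sequence.IsRegular (MvPolynomial (Fin n) K) (List.ofFn f) ∧
    IsMinimalGenerators (Fin.append f g) I

/-- A monomial ideal: an ideal generated by monomials. -/
def IsMonomialIdeal (J : Ideal (MvPolynomial (Fin n) K)) : Prop :=
  ∃ S : Set (Fin n →₀ ℕ), J = Ideal.span ((fun u => monomial u (1 : K)) '' S)

/-- `S` is an initial segment of the monomials of degree `d` (given by their exponents) in the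
lexicographic order with `x_1 > ⋯ > x_n`: with every monomial it contains all greater ones of
degree `d`. Here `toLex u < toLex v` means that `u i < v i` for some `i` with `u j = v j` for all
`j < i`. -/
def IsLexSegment (d : ℕ) (S : Set (Fin n →₀ ℕ)) : Prop :=
  (∀ u ∈ S, u.degree = d) ∧
    ∀ u ∈ S, ∀ v : Fin n →₀ ℕ, v.degree = d → toLex u < toLex v → v ∈ S

/-- A lexicographic ideal: a monomial ideal each of whose graded components is spanned over `K`
by an initial segment of the monomials of that degree. -/
def IsLexIdeal (J : Ideal (MvPolynomial (Fin n) K)) : Prop :=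
  IsMonomialIdeal J ∧ ∀ d, ∃ S : Set (Fin n →₀ ℕ), IsLexSegment d S ∧
    component J d = Submodule.span K ((fun u => monomial u (1 : K)) '' S)

/-- A lex-plus-powers ideal with respect to `a`: an ideal `(x_1^{a_1}, …, x_n^{a_n}) + J` with
`J` a lexicographic ideal. -/
def IsLexPlusPowers (a : Fin n → ℕ) (L : Ideal (MvPolynomial (Fin n) K)) : Prop :=
  ∃ J : Ideal (MvPolynomial (Fin n) K), IsLexIdeal J ∧
    L = Ideal.span (Set.range fun i => (X i : MvPolynomial (Fin n) K) ^ a i) ⊔ J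

/-- `EGH_{a,n}(d)` holds for the ideal `I`: some lex-plus-powers ideal containing the `x_i^{a_i}`
has the same Hilbert function as `I` in the degrees `d` and `d + 1`. -/
def HoldsFor (a : Fin n → ℕ) (d : ℕ) (I : Ideal (MvPolynomial (Fin n) K)) : Prop :=
  ∃ L : Ideal (MvPolynomial (Fin n) K), IsLexPlusPowers a L ∧
    hilbert I d = hilbert L d ∧ hilbert I (d + 1) = hilbert L (d + 1)

end EGH

end

/-! Multiplying the n + 2 generators by linear forms maps a space of dimension n(n + 2) to I_3, so
the bound says that there are at most five linear syzygies. The regular sequence F has only Koszul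
syzygies, whose coefficients have degree at least two. A linear syzygy is therefore determined by
its pair (P, Q) of linear forms with P g + Q h ∈ (F), and the task is to bound the space S of such
pairs (`finrank_lt_six`).

Suppose dim S ≥ 6, over an algebraically closed field. Koszul exactness and degree counting show
that a quadric outside (F) is killed modulo (F) by at most two independent linear forms, and a cubic
by at most three (`mem_of_three_lin_mul_mem`, `mem_of_four_lin_mul_mem`). Hence a linear form
killing one member of the pencil of g and h kills both. The space A of common annihilators is at
most a line, by `mem_of_two_lin_mul_mem`. One linear condition on S, transverse to A, leaves five
syzygies (l_i, m_i) with the l_i independent and the m_i independent. The pencil of l and m has no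
invariant plane: triangularising on one would give two independent elements of A.

For such a 2 × 5 matrix write l g + m h = ∑ b_s F_s. The entries of b_s ∧ l ∧ m lie in (F), with
linear coefficients x such that x ∧ l = x ∧ m = 0. Polarisation and the absence of an invariant
plane force x = 0. As the 2 × 2 minors have no common factor, b_s = α_s l + β_s m with constants,
and then g ∈ (F), a contradiction (`mem_of_five_syzygies`).

For EGH, the monomials x_1², …, x_n², x_1x_2, x_1x_3 generate at most n² + 2n − 5 cubics. Enlarging
a lex segment of cubics one monomial at a time reaches every value from there to dim R_3, in
particular dim I_3. -/

noncomputable section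

namespace EGH

open MvPolynomial

/-! ### Homogeneous components of products. -/

section Homogeneous

variable {σ K : Type*} [Field K]

lemma homogeneousComponent_mul_isHomogeneous (a p : MvPolynomial σ K) {d : ℕ}
    (hp : p.IsHomogeneous d) (m : ℕ) :
    homogeneousComponent (m + d) (a * p) = homogeneousComponent m a * p := by
  classical
  conv_lhs => rw [← sum_homogeneousComponent a, Finset.sum_mul, map_sum]
  have key : ∀ i, homogeneousComponent (m + d) (homogeneousComponent i a * p) =
      if i = m then homogeneousComponent i a * p else 0 := by
    intro i
    rw [homogeneousComponent_of_mem (m := m + d) (n := i + d)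
      ((homogeneousComponent_isHomogeneous i a).mul hp)]
    by_cases h : i = m
    · simp [h]
    · rw [if_neg (by omega), if_neg h]
  simp only [key]
  rw [Finset.sum_ite_eq']
  split_ifs with h
  · rfl
  · rw [homogeneousComponent_eq_zero _ _ (by simpa using h), zero_mul]

lemma homogeneousComponent_mul_of_lt (a p : MvPolynomial σ K) {d m : ℕ}
    (hp : p.IsHomogeneous d) (h : m < d) : homogeneousComponent m (a * p) = 0 := by
  conv_lhs => rw [← sum_homogeneousComponent a, Finset.sum_mul, map_sum]
  refine Finset.sum_eq_zero fun i _ => ?_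
  rw [homogeneousComponent_of_mem (m := m) (n := i + d)
      ((homogeneousComponent_isHomogeneous i a).mul hp), if_neg (by omega)]

lemma exists_C_of_isHomogeneous_zero {p : MvPolynomial σ K} (hp : p.IsHomogeneous 0) :
    ∃ a : K, p = C a :=
  ⟨coeff 0 p, totalDegree_eq_zero_iff_eq_C.1 ((totalDegree_zero_iff_isHomogeneous _).2 hp)⟩

end Homogeneous

/-! ### Linear forms as functionals; divisibility by them. -/

section LinearForms

variable {K : Type*} [Field K] {n : ℕ}

/-- The linear form in `K[x_1, …, x_n]` given by a linear functional on `K^n`. -/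
def lin : Module.Dual K (Fin n → K) →ₗ[K] MvPolynomial (Fin n) K :=
  ∑ i : Fin n, (Module.Dual.eval K (Fin n → K) (Pi.single i 1)).smulRight (X i)

lemma lin_apply (φ : Module.Dual K (Fin n → K)) :
    lin φ = ∑ i : Fin n, φ (Pi.single i 1) • (X i : MvPolynomial (Fin n) K) := by
  simp [lin]

lemma isHomogeneous_lin (φ : Module.Dual K (Fin n → K)) : (lin φ).IsHomogeneous 1 := by
  rw [lin_apply]
  refine IsHomogeneous.sum _ _ _ fun i _ => ?_
  rw [smul_eq_C_mul]
  exact isHomogeneous_C_mul_X _ _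

@[simp] lemma eval_lin (φ : Module.Dual K (Fin n → K)) (θ : Fin n → K) :
    eval θ (lin φ) = φ θ := by
  rw [lin_apply, map_sum]
  conv_rhs => rw [← Finset.univ_sum_single θ, map_sum]
  refine Finset.sum_congr rfl fun i _ => ?_
  rw [smul_eval, eval_X]
  have : (Pi.single i (θ i) : Fin n → K) = θ i • Pi.single i 1 := by
    rw [← Pi.single_smul]; simp
  rw [this, map_smul, smul_eq_mul, mul_comm]

lemma lin_injective : Function.Injective (lin : Module.Dual K (Fin n → K) →ₗ[K] _) := by
  intro φ ψ h
  refine LinearMap.ext fun θ => ?_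
  rw [← eval_lin, h, eval_lin]

@[simp] lemma lin_eq_zero {φ : Module.Dual K (Fin n → K)} : lin φ = 0 ↔ φ = 0 :=
  map_eq_zero_iff lin lin_injective

lemma exists_lin {p : MvPolynomial (Fin n) K} (hp : p.IsHomogeneous 1) :
    ∃ φ : Module.Dual K (Fin n → K), p = lin φ := by
  have h : p ∈ homogeneousSubmodule (Fin n) K 1 := hp
  rw [homogeneousSubmodule_one_eq_span_X] at h
  obtain ⟨c, rfl⟩ := (Submodule.mem_span_range_iff_exists_fun K).1 h
  refine ⟨∑ i, c i • LinearMap.proj i, ?_⟩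
  rw [lin_apply]
  refine Finset.sum_congr rfl fun i _ => ?_
  congr 1
  simp [Pi.single_apply]

lemma lin_prime {φ : Module.Dual K (Fin n → K)} (h : φ ≠ 0) : Prime (lin φ) := by
  have hl : lin φ ≠ 0 := by simpa using h
  rw [← UniqueFactorizationMonoid.irreducible_iff_prime]
  refine irreducible_of_totalDegree_eq_one ((isHomogeneous_lin φ).totalDegree hl) ?_
  intro x hx
  by_contra hu
  have hx0 : x = 0 := by
    by_contra h0
    exact hu (isUnit_iff_ne_zero.2 h0)
  apply hl
  ext d
  have := hx d
  rw [hx0, zero_dvd_iff] at this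
  simpa using this

/-- `lin φ` is prime and cannot divide `lin ψ`, because the quotient would be a constant. -/
lemma eq_mul_lin_of_mul_lin_eq {φ ψ : Module.Dual K (Fin n → K)}
    (h : LinearIndependent K ![φ, ψ]) {a b : MvPolynomial (Fin n) K}
    (hab : a * lin ψ = b * lin φ) : ∃ r, a = r * lin φ := by
  have hφ : φ ≠ 0 := h.ne_zero 0
  have hd : lin φ ∣ a * lin ψ := ⟨b, by rw [hab, mul_comm]⟩
  rcases (lin_prime hφ).dvd_or_dvd hd with ⟨r, hr⟩ | ⟨r, hr⟩
  · exact ⟨r, by rw [hr, mul_comm]⟩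
  · exfalso
    have hψ : ψ ≠ 0 := h.ne_zero 1
    have hl : lin ψ ≠ 0 := by simpa using hψ
    have hr0 : r ≠ 0 := by rintro rfl; simp [hψ] at hr
    have hdeg := congrArg MvPolynomial.totalDegree hr
    rw [totalDegree_mul_of_isDomain (by simpa using hφ) hr0, (isHomogeneous_lin ψ).totalDegree hl,
      (isHomogeneous_lin φ).totalDegree (by simpa using hφ)] at hdeg
    obtain ⟨c, rfl⟩ := exists_C_of_isHomogeneous_zero
      ((totalDegree_zero_iff_isHomogeneous _).1 (show r.totalDegree = 0 by omega))
    have : ψ = c • φ := by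
      apply lin_injective
      rw [hr, map_smul, smul_eq_C_mul, mul_comm]
    rw [LinearIndependent.pair_iff] at h
    have := h c (-1) (by simp [this])
    simp at this

lemma isHomogeneous_of_mul_lin {φ : Module.Dual K (Fin n → K)} (hφ : φ ≠ 0)
    {r : MvPolynomial (Fin n) K} {d : ℕ} (h : (r * lin φ).IsHomogeneous (d + 1)) :
    r.IsHomogeneous d := by
  have h1 := homogeneousComponent_mul_isHomogeneous r (lin φ) (isHomogeneous_lin φ) d
  rw [homogeneousComponent_of_mem (n := d + 1) h, if_pos rfl] at h1
  have := mul_right_cancel₀ (by simpa using hφ) h1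
  rw [this]
  exact homogeneousComponent_isHomogeneous _ _

end LinearForms

/-! ### Koszul syzygies of a regular sequence, degree by degree. -/

section Koszul

variable {K : Type*} [Field K] {n : ℕ}

/-- Every syzygy of the family `F` is given by an alternating matrix: exactness of the Koszul
complex of `F` at its second term. -/
def HasKoszulSyzygies {ι R : Type*} [Fintype ι] [CommRing R] (F : ι → R) : Prop :=
  ∀ c : ι → R, ∑ s, c s * F s = 0 →
    ∃ b : ι → ι → R, (∀ s t, b s t = -b t s) ∧ (∀ s, b s s = 0) ∧ ∀ s, c s = ∑ t, b s t * F t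

/-- Induction on the length. The last coefficient is a combination `d` of the earlier members;
moving it onto them leaves a syzygy of the shorter sequence. -/
lemma hasKoszulSyzygies_of_mul_mem {R : Type*} [CommRing R] :
    ∀ {r : ℕ} (F : Fin r → R),
      (∀ k : Fin r, ∀ c : R, c * F k ∈ Ideal.span (F '' {j | j < k}) →
        c ∈ Ideal.span (F '' {j | j < k})) → HasKoszulSyzygies F := by
  intro r
  induction r with
  | zero => exact fun F _ c _ => ⟨fun _ _ => 0, by simp, by simp, fun s => s.elim0⟩
  | succ r ih =>
    intro F hF c hc
    have himg : ∀ k : Fin r, F '' {j | j < k.castSucc} = (F ∘ Fin.castSucc) '' {j | j < k} := by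
      intro k
      ext x
      constructor
      · rintro ⟨j, hj, rfl⟩
        have hj' : j < k.castSucc := hj
        refine ⟨j.castLT (by have := Fin.lt_def.1 hj'; simp at this; omega), Fin.lt_def.2 ?_, by simp⟩
        exact Fin.lt_def.1 hj'
      · rintro ⟨j, hj, rfl⟩
        exact ⟨j.castSucc, Fin.castSucc_lt_castSucc_iff.2 hj, rfl⟩
    have himg' : F '' {j | j < Fin.last r} = Set.range (F ∘ Fin.castSucc) := by
      ext x
      constructor
      · rintro ⟨j, hj, rfl⟩
        have hj' : j < Fin.last r := hj
        exact ⟨j.castLT (by simpa [Fin.lt_def] using hj'), by simp⟩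
      · rintro ⟨j, rfl⟩
        exact ⟨j.castSucc, Fin.castSucc_lt_last j, rfl⟩
    have ih' := ih (F ∘ Fin.castSucc) (fun k a ha => by
      rw [← himg] at ha ⊢
      exact hF _ _ ha)
    rw [Fin.sum_univ_castSucc] at hc
    have hlast : c (Fin.last r) ∈ Ideal.span (F '' {j | j < Fin.last r}) := by
      apply hF
      rw [himg', ← neg_mem_iff]
      have : -(c (Fin.last r) * F (Fin.last r)) = ∑ i : Fin r, c i.castSucc * F i.castSucc := by
        linear_combination -hc
      rw [this]
      exact Ideal.sum_mem _ fun i _ => Ideal.mul_mem_left _ _ (Ideal.subset_span ⟨i, rfl⟩)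
    rw [himg'] at hlast
    obtain ⟨d, hd⟩ := Ideal.mem_span_range_iff_exists_fun.1 hlast
    obtain ⟨b, hb1, hb2, hb3⟩ := ih' (fun s => c s.castSucc + d s * F (Fin.last r)) (by
      have : ∑ s, (c s.castSucc + d s * F (Fin.last r)) * (F ∘ Fin.castSucc) s =
          ∑ s : Fin r, c s.castSucc * F s.castSucc +
            (∑ s : Fin r, d s * (F ∘ Fin.castSucc) s) * F (Fin.last r) := by
        rw [Finset.sum_mul, ← Finset.sum_add_distrib]
        exact Finset.sum_congr rfl fun s _ => by simp only [Function.comp]; ring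
      rw [this, hd, hc])
    -- The matrix of the shorter syzygy, bordered by `d` in the last row and `-d` in the last
    -- column.
    let B : Fin (r + 1) → Fin (r + 1) → R :=
      Fin.lastCases (Fin.lastCases 0 d)
        (fun s => Fin.lastCases (-d s) (b s))
    have B1 : B (Fin.last r) (Fin.last r) = 0 := by simp [B]
    have B2 : ∀ s : Fin r, B (Fin.last r) s.castSucc = d s := by intro s; simp [B]
    have B3 : ∀ s : Fin r, B s.castSucc (Fin.last r) = -d s := by intro s; simp [B]
    have B4 : ∀ s t : Fin r, B s.castSucc t.castSucc = b s t := by intro s t; simp [B]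
    refine ⟨B, ?_, ?_, ?_⟩
    · intro s t
      induction s using Fin.lastCases <;> induction t using Fin.lastCases
      · simp [B1]
      · simp [B2, B3]
      · simp [B2, B3]
      · rw [B4, B4, hb1]
    · intro s
      induction s using Fin.lastCases
      · exact B1
      · rw [B4, hb2]
    · intro s
      rw [Fin.sum_univ_castSucc]
      induction s using Fin.lastCases with
      | last => simp only [B1, B2]; rw [← hd]; simp
      | cast s =>
        simp only [B3, B4]
        have := hb3 s
        simp only [Function.comp] at this
        linear_combination this

lemma hasKoszulSyzygies_of_isWeaklyRegular {R : Type*} [CommRing R] {r : ℕ} (F : Fin r → R)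
    (h : RingTheory.Sequence.IsWeaklyRegular R (List.ofFn F)) : HasKoszulSyzygies F := by
  refine hasKoszulSyzygies_of_mul_mem F fun k c hc => ?_
  have h1 := h.regular_mod_prev k (by simp)
  have hI : (Ideal.ofList ((List.ofFn F).take k) • ⊤ : Submodule R R) =
      Ideal.span (F '' {j | j < k}) := by
    rw [smul_eq_mul, Ideal.mul_top, Ideal.ofList]
    congr 1
    ext x
    simp only [Set.mem_ofPred_eq, Set.mem_image, List.mem_take_iff_getElem, List.getElem_ofFn,
      List.length_ofFn]
    constructor
    · rintro ⟨i, hi, rfl⟩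
      exact ⟨⟨i, by omega⟩, by simp [Fin.lt_def]; omega, rfl⟩
    · rintro ⟨j, hj, rfl⟩
      exact ⟨j, by have := Fin.lt_def.1 hj; omega, rfl⟩
  rw [hI] at h1
  have h2 := @h1 (Submodule.Quotient.mk c) (Submodule.Quotient.mk 0) (by
    simp only [← Submodule.Quotient.mk_smul, smul_zero]
    rw [Submodule.Quotient.eq, sub_zero]
    simpa [mul_comm] using hc)
  rwa [Submodule.Quotient.eq, sub_zero] at h2

variable {ι : Type*} [Fintype ι] {F : ι → MvPolynomial (Fin n) K}

lemma mem_span_isHomogeneous (hF : ∀ s, (F s).IsHomogeneous 2) {p : MvPolynomial (Fin n) K}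
    {d : ℕ} (hp : p.IsHomogeneous (d + 2)) (h : p ∈ Ideal.span (Set.range F)) :
    ∃ b : ι → MvPolynomial (Fin n) K, (∀ s, (b s).IsHomogeneous d) ∧ p = ∑ s, b s * F s := by
  obtain ⟨b, hb⟩ := Ideal.mem_span_range_iff_exists_fun.1 h
  refine ⟨fun s => homogeneousComponent d (b s), fun s => homogeneousComponent_isHomogeneous _ _,
    ?_⟩
  have : homogeneousComponent (d + 2) p = p := by
    rw [homogeneousComponent_of_mem (n := d + 2) hp, if_pos rfl]
  rw [← this, ← hb, map_sum]
  exact Finset.sum_congr rfl fun s _ => homogeneousComponent_mul_isHomogeneous _ _ (hF s) _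

lemma eq_zero_of_mem_span (hF : ∀ s, (F s).IsHomogeneous 2) {p : MvPolynomial (Fin n) K}
    {d : ℕ} (hp : p.IsHomogeneous d) (hd : d < 2) (h : p ∈ Ideal.span (Set.range F)) :
    p = 0 := by
  obtain ⟨b, hb⟩ := Ideal.mem_span_range_iff_exists_fun.1 h
  have : homogeneousComponent d p = p := by
    rw [homogeneousComponent_of_mem (n := d) hp, if_pos rfl]
  rw [← this, ← hb, map_sum]
  exact Finset.sum_eq_zero fun s _ => homogeneousComponent_mul_of_lt _ _ (hF s) hd

lemma HasKoszulSyzygies.mem (hK : HasKoszulSyzygies F) {c : ι → MvPolynomial (Fin n) K}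
    (h : ∑ s, c s * F s = 0) (s : ι) : c s ∈ Ideal.span (Set.range F) := by
  obtain ⟨b, -, -, hb⟩ := hK c h
  rw [hb]
  exact Ideal.sum_mem _ fun t _ => Ideal.mul_mem_left _ _ (Ideal.subset_span ⟨t, rfl⟩)

/-- The coefficients of a Koszul syzygy lie in the ideal of the quadrics, which is zero in degrees
below two. -/
lemma HasKoszulSyzygies.eq_zero (hK : HasKoszulSyzygies F) (hF : ∀ s, (F s).IsHomogeneous 2)
    {c : ι → MvPolynomial (Fin n) K} {d : ℕ} (hc : ∀ s, (c s).IsHomogeneous d) (hd : d < 2)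
    (h : ∑ s, c s * F s = 0) (s : ι) : c s = 0 :=
  eq_zero_of_mem_span hF (hc s) hd (hK.mem h s)

/-- Each application lowers the degree of the coefficients by two. Iterating it reaches constants,
where `HasKoszulSyzygies.eq_zero` ends the descent. -/
lemma HasKoszulSyzygies.exists_alternating (hK : HasKoszulSyzygies F)
    (hF : ∀ s, (F s).IsHomogeneous 2) {c : ι → MvPolynomial (Fin n) K} {d : ℕ}
    (hc : ∀ s, (c s).IsHomogeneous (d + 2)) (h : ∑ s, c s * F s = 0) :
    ∃ b : ι → ι → MvPolynomial (Fin n) K, (∀ s t, (b s t).IsHomogeneous d) ∧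
      (∀ s t, b s t = -b t s) ∧ (∀ s, b s s = 0) ∧ ∀ s, c s = ∑ t, b s t * F t := by
  obtain ⟨b, h1, h2, h3⟩ := hK c h
  refine ⟨fun s t => homogeneousComponent d (b s t),
    fun s t => homogeneousComponent_isHomogeneous _ _, fun s t => ?_, fun s => ?_, fun s => ?_⟩
  · simp only [← map_neg]
    rw [h1]
  · simp only [h2, map_zero]
  · have : homogeneousComponent (d + 2) (c s) = c s := by
      rw [homogeneousComponent_of_mem (n := d + 2) (hc s), if_pos rfl]
    rw [← this, h3, map_sum]
    exact Finset.sum_congr rfl fun s _ => homogeneousComponent_mul_isHomogeneous _ _ (hF _) _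

end Koszul

/-! ### Independent functionals take arbitrary values. -/

section LinearAlgebra

variable {K V : Type*} [Field K] [AddCommGroup V] [Module K V]

/-- A nonzero functional vanishing on the image would be a linear relation among the `φ i`. -/
lemma pi_surjective_of_linearIndependent {k : ℕ} {φ : Fin k → Module.Dual K V}
    (h : LinearIndependent K φ) : Function.Surjective (LinearMap.pi φ) := by
  rw [← LinearMap.range_eq_top]
  by_contra hne
  obtain ⟨f, hf0, hf⟩ := Submodule.exists_dual_map_eq_bot_of_lt_top (lt_top_iff_ne_top.2 hne)
    inferInstance
  apply hf0
  have h1 : ∑ i, f (Pi.single i 1) • φ i = 0 := by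
    refine LinearMap.ext fun θ => ?_
    have h2 : f (LinearMap.pi φ θ) = 0 := by
      have : f (LinearMap.pi φ θ) ∈ Submodule.map f (LinearMap.range (LinearMap.pi φ)) :=
        ⟨_, ⟨θ, rfl⟩, rfl⟩
      rw [hf] at this
      simpa using this
    rw [← Finset.univ_sum_single (LinearMap.pi φ θ), map_sum] at h2
    rw [LinearMap.sum_apply, LinearMap.zero_apply, ← h2]
    refine Finset.sum_congr rfl fun i _ => ?_
    have : (Pi.single i (LinearMap.pi φ θ i) : Fin k → K) = φ i θ • Pi.single i 1 := by
      rw [← Pi.single_smul]; simp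
    rw [this, map_smul, LinearMap.smul_apply, smul_eq_mul, smul_eq_mul, mul_comm]
  have h3 := Fintype.linearIndependent_iff.1 h _ h1
  refine LinearMap.pi_ext' fun i => ?_
  ext
  simpa using h3 i

end LinearAlgebra

/-! ### Linear forms annihilating quadrics and cubics modulo F. -/

section Annihilators

variable {K : Type*} [Field K] {n : ℕ} {ι : Type*} [Fintype ι] {F : ι → MvPolynomial (Fin n) K}

lemma sum_alternating_mul {R : Type*} [CommRing R] (a : ι → ι → R) (h : ∀ s t, a s t = -a t s)
    (h0 : ∀ s, a s s = 0) (F : ι → R) : ∑ s, (∑ t, a s t * F t) * F s = 0 := by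
  classical
  simp only [Finset.sum_mul]
  rw [← Finset.sum_product']
  refine Finset.sum_involution (fun p _ => p.swap) ?_ ?_ ?_ ?_
  · rintro ⟨s, t⟩ -
    simp only [Prod.swap]
    rw [h s t]; ring
  · rintro ⟨s, t⟩ - hne heq
    have : t = s := congrArg Prod.fst heq
    subst this
    simp [h0] at hne
  · simp
  · simp

lemma lin_mul_left_cancel {φ : Module.Dual K (Fin n → K)} (hφ : φ ≠ 0)
    {p q : MvPolynomial (Fin n) K} (h : lin φ * p = lin φ * q) : p = q :=
  mul_left_cancel₀ (by simpa using hφ) h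

/-- A linear form `a` with `a v₂ ∈ (v₀, v₁)` is a combination of `v₀` and `v₁`. -/
lemma exists_lin_comb {φ : Fin 3 → Module.Dual K (Fin n → K)} (hφ : LinearIndependent K φ)
    {a b c : MvPolynomial (Fin n) K} (ha : a.IsHomogeneous 1)
    (h : a * lin (φ 2) - b * lin (φ 1) + c * lin (φ 0) = 0) :
    ∃ x y : K, a = C x * lin (φ 1) - C y * lin (φ 0) := by
  obtain ⟨α, rfl⟩ := exists_lin ha
  obtain ⟨θ₀, hθ₀⟩ := pi_surjective_of_linearIndependent hφ ![0, 0, 1]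
  have e0 : φ 0 θ₀ = 0 := by simpa using congrFun hθ₀ 0
  have e1 : φ 1 θ₀ = 0 := by simpa using congrFun hθ₀ 1
  have e2 : φ 2 θ₀ = 1 := by simpa using congrFun hθ₀ 2
  have key : ∀ θ, φ 0 θ = 0 → φ 1 θ = 0 → α θ * φ 2 θ = 0 := by
    intro θ h0 h1
    have := congrArg (eval θ) h
    simpa [h0, h1] using this
  have hα : α ∈ Submodule.span K (Set.range ![φ 0, φ 1]) := by
    refine mem_span_of_iInf_ker_le_ker fun θ hθ => ?_
    simp only [Submodule.mem_iInf, LinearMap.mem_ker] at hθ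
    have h0 : φ 0 θ = 0 := hθ 0
    have h1 : φ 1 θ = 0 := hθ 1
    have k1 := key θ h0 h1
    have k2 := key θ₀ e0 e1
    -- Where `φ 2 θ = 0` the relation says nothing about `α θ`; the shift by `θ₀` makes the value of
    -- `φ 2` grow by one. This works over any field.
    have k3 := key (θ + θ₀) (by simp [h0, e0]) (by simp [h1, e1])
    rw [e2, mul_one] at k2
    rw [map_add, map_add, e2, k2, add_zero, mul_add, k1] at k3
    simpa using k3
  obtain ⟨w, hw⟩ := (Submodule.mem_span_range_iff_exists_fun K).1 hα
  refine ⟨w 1, -w 0, ?_⟩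
  rw [← hw]
  simp [Fin.sum_univ_two, smul_eq_C_mul]
  ring

lemma isHomogeneous_mul_lin {p : MvPolynomial (Fin n) K} (hp : p.IsHomogeneous 0)
    (φ : Module.Dual K (Fin n → K)) : (p * lin φ).IsHomogeneous 1 := by
  simpa using hp.mul (isHomogeneous_lin φ)

lemma C_eq_zero_of_sum_lin {k : ℕ} {φ : Fin k → Module.Dual K (Fin n → K)}
    (hφ : LinearIndependent K φ) {x : Fin k → K} (h : ∑ i, C (x i) * lin (φ i) = 0) (i : Fin k) :
    x i = 0 := by
  refine Fintype.linearIndependent_iff.1 hφ x ?_ i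
  apply lin_injective
  simp only [map_sum, map_smul, smul_eq_C_mul, map_zero, h]

/-- A quadric annihilated modulo `F` by three independent linear forms vanishes modulo `F`. -/
lemma mem_of_three_lin_mul_mem (hK : HasKoszulSyzygies F) (hF : ∀ s, (F s).IsHomogeneous 2)
    {φ : Fin 3 → Module.Dual K (Fin n → K)} (hφ : LinearIndependent K φ)
    {g : MvPolynomial (Fin n) K} (hg : g.IsHomogeneous 2)
    (h : ∀ i, lin (φ i) * g ∈ Ideal.span (Set.range F)) : g ∈ Ideal.span (Set.range F) := by
  have hb : ∀ i, ∃ b : ι → MvPolynomial (Fin n) K, (∀ s, (b s).IsHomogeneous 1) ∧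
      lin (φ i) * g = ∑ s, b s * F s := fun i =>
    mem_span_isHomogeneous hF ((isHomogeneous_lin _).mul hg) (h i)
  choose b hb1 hb2 using hb
  -- Eliminating g from two of the relations gives a quadratic syzygy of F, hence constants `c i j`.
  have hc : ∀ i j, ∃ c : ι → ι → MvPolynomial (Fin n) K, (∀ s t, (c s t).IsHomogeneous 0) ∧
      (∀ s t, c s t = -c t s) ∧ (∀ s, c s s = 0) ∧
      ∀ s, b i s * lin (φ j) - b j s * lin (φ i) = ∑ t, c s t * F t := by
    intro i j
    refine hK.exists_alternating hF (fun s => ((hb1 i s).mul (isHomogeneous_lin _)).sub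
      ((hb1 j s).mul (isHomogeneous_lin _))) ?_
    have : ∑ s, (b i s * lin (φ j) - b j s * lin (φ i)) * F s =
        lin (φ j) * ∑ s, b i s * F s - lin (φ i) * ∑ s, b j s * F s := by
      simp only [Finset.mul_sum, ← Finset.sum_sub_distrib]
      exact Finset.sum_congr rfl fun s _ => by ring
    rw [this, ← hb2, ← hb2]; ring
  choose c hc1 _ _ hc2 using hc
  -- The alternating sum of the `c i j` against the third form is a linear syzygy of F, so it
  -- vanishes, and independence of the `φ i` kills the constants. Then `lin (φ 0)` divides every `b
  -- 0 s` and can be cancelled.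
  have hc3 : ∀ s t, c 0 1 s t = 0 := by
    intro s t
    have h0 := hK.eq_zero hF (d := 1)
      (c := fun t => c 0 1 s t * lin (φ 2) - c 0 2 s t * lin (φ 1) + c 1 2 s t * lin (φ 0))
      (fun t => ((isHomogeneous_mul_lin (hc1 0 1 s t) _).sub
        (isHomogeneous_mul_lin (hc1 0 2 s t) _)).add
          (isHomogeneous_mul_lin (hc1 1 2 s t) _)) (by norm_num) (by
        have : ∑ t, (c 0 1 s t * lin (φ 2) - c 0 2 s t * lin (φ 1) + c 1 2 s t * lin (φ 0)) * F t =
            lin (φ 2) * ∑ t, c 0 1 s t * F t - lin (φ 1) * ∑ t, c 0 2 s t * F t +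
              lin (φ 0) * ∑ t, c 1 2 s t * F t := by
          simp only [Finset.mul_sum, ← Finset.sum_sub_distrib, ← Finset.sum_add_distrib]
          exact Finset.sum_congr rfl fun s _ => by ring
        rw [this, ← hc2, ← hc2, ← hc2]; ring) t
    obtain ⟨x, hx⟩ := exists_C_of_isHomogeneous_zero (hc1 0 1 s t)
    obtain ⟨y, hy⟩ := exists_C_of_isHomogeneous_zero (hc1 0 2 s t)
    obtain ⟨z, hz⟩ := exists_C_of_isHomogeneous_zero (hc1 1 2 s t)
    rw [hx, hy, hz] at h0
    have := C_eq_zero_of_sum_lin hφ (x := ![z, -y, x]) (by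
      rw [← h0, Fin.sum_univ_three]; simp; ring) 2
    have hx0 : x = 0 := this
    rw [hx, hx0, C_0]
  have hr : ∀ s, ∃ r, b 0 s = r * lin (φ 0) := by
    intro s
    refine eq_mul_lin_of_mul_lin_eq (ψ := φ 1) (b := b 1 s) ?_ ?_
    · convert hφ.comp (Fin.castSucc : Fin 2 → Fin 3) (Fin.castSucc_injective 2) using 1
      ext i; fin_cases i <;> rfl
    · have := hc2 0 1 s
      simp only [hc3, zero_mul, Finset.sum_const_zero] at this
      linear_combination this
  choose r hr using hr
  have : g = ∑ s, r s * F s := by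
    apply lin_mul_left_cancel (hφ.ne_zero 0)
    rw [hb2, Finset.mul_sum]
    exact Finset.sum_congr rfl fun s _ => by rw [hr]; ring
  rw [this]
  exact Ideal.sum_mem _ fun t _ => Ideal.mul_mem_left _ _ (Ideal.subset_span ⟨t, rfl⟩)

/-- A cubic annihilated modulo `F` by four independent linear forms vanishes modulo `F`. -/
lemma mem_of_four_lin_mul_mem (hK : HasKoszulSyzygies F) (hF : ∀ s, (F s).IsHomogeneous 2)
    {φ : Fin 4 → Module.Dual K (Fin n → K)} (hφ : LinearIndependent K φ)
    {g : MvPolynomial (Fin n) K} (hg : g.IsHomogeneous 3)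
    (h : ∀ i, lin (φ i) * g ∈ Ideal.span (Set.range F)) : g ∈ Ideal.span (Set.range F) := by
  have hb : ∀ i, ∃ b : ι → MvPolynomial (Fin n) K, (∀ s, (b s).IsHomogeneous 2) ∧
      lin (φ i) * g = ∑ s, b s * F s := fun i =>
    mem_span_isHomogeneous hF ((isHomogeneous_lin _).mul hg) (h i)
  choose b hb1 hb2 using hb
  have hc : ∀ i j, ∃ c : ι → ι → MvPolynomial (Fin n) K, (∀ s t, (c s t).IsHomogeneous 1) ∧
      (∀ s t, c s t = -c t s) ∧ (∀ s, c s s = 0) ∧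
      ∀ s, b i s * lin (φ j) - b j s * lin (φ i) = ∑ t, c s t * F t := by
    intro i j
    refine hK.exists_alternating hF (fun s => ((hb1 i s).mul (isHomogeneous_lin _)).sub
      ((hb1 j s).mul (isHomogeneous_lin _))) ?_
    have : ∑ s, (b i s * lin (φ j) - b j s * lin (φ i)) * F s =
        lin (φ j) * ∑ s, b i s * F s - lin (φ i) * ∑ s, b j s * F s := by
      simp only [Finset.mul_sum, ← Finset.sum_sub_distrib]
      exact Finset.sum_congr rfl fun s _ => by ring
    rw [this, ← hb2, ← hb2]; ring
  choose c hc1 hca hcd hc2 using hc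
  -- For a cubic the `c i j` are linear, so a second elimination is needed to reach constants; the
  -- fourth form makes those vanish.
  have hd : ∀ i j k s, ∃ d : ι → ι → MvPolynomial (Fin n) K, (∀ t u, (d t u).IsHomogeneous 0) ∧
      (∀ s t, d s t = -d t s) ∧ (∀ s, d s s = 0) ∧
      ∀ t, c i j s t * lin (φ k) - c i k s t * lin (φ j) + c j k s t * lin (φ i) =
        ∑ u, d t u * F u := by
    intro i j k s
    refine hK.exists_alternating hF (fun t => (((hc1 i j s t).mul (isHomogeneous_lin (φ k))).sub
        ((hc1 i k s t).mul (isHomogeneous_lin (φ j)))).add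
          ((hc1 j k s t).mul (isHomogeneous_lin (φ i)))) ?_
    have : ∑ t, (c i j s t * lin (φ k) - c i k s t * lin (φ j) + c j k s t * lin (φ i)) * F t =
        lin (φ k) * ∑ t, c i j s t * F t - lin (φ j) * ∑ t, c i k s t * F t +
          lin (φ i) * ∑ t, c j k s t * F t := by
      simp only [Finset.mul_sum, ← Finset.sum_sub_distrib, ← Finset.sum_add_distrib]
      exact Finset.sum_congr rfl fun s _ => by ring
    rw [this, ← hc2, ← hc2, ← hc2]; ring
  choose d hd1 _ _ hd2 using hd
  have hd3 : ∀ s t u, d 0 1 2 s t u = 0 := by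
    intro s t u
    have h0 := hK.eq_zero hF (d := 1)
      (c := fun u => d 0 1 2 s t u * lin (φ 3) - d 0 1 3 s t u * lin (φ 2) +
        (d 0 2 3 s t u * lin (φ 1) - d 1 2 3 s t u * lin (φ 0)))
      (fun u => ((isHomogeneous_mul_lin (hd1 0 1 2 s t u) _).sub
        (isHomogeneous_mul_lin (hd1 0 1 3 s t u) _)).add
          ((isHomogeneous_mul_lin (hd1 0 2 3 s t u) _).sub
          (isHomogeneous_mul_lin (hd1 1 2 3 s t u) _))) (by norm_num) (by
        have : ∑ u, (d 0 1 2 s t u * lin (φ 3) - d 0 1 3 s t u * lin (φ 2) +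
            (d 0 2 3 s t u * lin (φ 1) - d 1 2 3 s t u * lin (φ 0))) * F u =
            lin (φ 3) * ∑ u, d 0 1 2 s t u * F u - lin (φ 2) * ∑ u, d 0 1 3 s t u * F u +
              (lin (φ 1) * ∑ u, d 0 2 3 s t u * F u - lin (φ 0) * ∑ u, d 1 2 3 s t u * F u) := by
          simp only [Finset.mul_sum, ← Finset.sum_sub_distrib, ← Finset.sum_add_distrib]
          exact Finset.sum_congr rfl fun s _ => by ring
        rw [this, ← hd2, ← hd2, ← hd2, ← hd2]; ring) u
    obtain ⟨x, hx⟩ := exists_C_of_isHomogeneous_zero (hd1 0 1 2 s t u)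
    obtain ⟨y, hy⟩ := exists_C_of_isHomogeneous_zero (hd1 0 1 3 s t u)
    obtain ⟨z, hz⟩ := exists_C_of_isHomogeneous_zero (hd1 0 2 3 s t u)
    obtain ⟨w, hw⟩ := exists_C_of_isHomogeneous_zero (hd1 1 2 3 s t u)
    rw [hx, hy, hz, hw] at h0
    have := C_eq_zero_of_sum_lin hφ (x := ![-w, z, -y, x]) (by
      rw [← h0, Fin.sum_univ_four]; simp; ring) 3
    have hx0 : x = 0 := this
    rw [hx, hx0, C_0]
  have hφ3 : LinearIndependent K ![φ 0, φ 1, φ 2] := by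
    convert hφ.comp (Fin.castSucc : Fin 3 → Fin 4) (Fin.castSucc_injective 3) using 1
    ext i; fin_cases i <;> rfl
  have hφ2 : LinearIndependent K ![φ 0, φ 1] := by
    convert hφ3.comp (Fin.castSucc : Fin 2 → Fin 3) (Fin.castSucc_injective 2) using 1
    ext i; fin_cases i <;> rfl
  have hx : ∀ s t, ∃ x y : K, c 0 1 s t = C x * lin (φ 1) - C y * lin (φ 0) := by
    intro s t
    refine exists_lin_comb hφ3 (hc1 0 1 s t) (b := c 0 2 s t) (c := c 1 2 s t) ?_
    have := hd2 0 1 2 s t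
    simp only [hd3, zero_mul, Finset.sum_const_zero] at this
    exact this
  choose x y hxy using hx
  have hpair : ∀ p q : K, C p * lin (φ 1) - C q * lin (φ 0) = 0 → p = 0 ∧ q = 0 := by
    intro p q hpq
    have := C_eq_zero_of_sum_lin hφ2 (x := ![-q, p]) (by
      rw [← hpq, Fin.sum_univ_two]; simp; ring)
    exact ⟨this 1, neg_eq_zero.1 (this 0)⟩
  have hxa : ∀ s t, x s t = -x t s := by
    intro s t
    have := hca 0 1 s t
    rw [hxy, hxy] at this
    exact eq_neg_of_add_eq_zero_left (hpair (x s t + x t s) (y s t + y t s) (by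
      rw [C_add, C_add]; linear_combination this)).1
  have hya : ∀ s t, y s t = -y t s := by
    intro s t
    have := hca 0 1 s t
    rw [hxy, hxy] at this
    exact eq_neg_of_add_eq_zero_left (hpair (x s t + x t s) (y s t + y t s) (by
      rw [C_add, C_add]; linear_combination this)).2
  -- The diagonal needs its own argument, since antisymmetry does not give zero in characteristic
  -- two.
  have hxd : ∀ s, x s s = 0 := by
    intro s
    have := hcd 0 1 s
    rw [hxy] at this
    exact (hpair _ _ this).1
  -- The matrix `x` is alternating, so subtracting `∑ t, C (x s t) * F t` from `b 0 s` leaves `∑ s,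
  -- b 0 s * F s` unchanged. After this correction `lin (φ 0)` divides each coefficient.
  have hr : ∀ s, ∃ r, b 0 s - ∑ t, C (x s t) * F t = r * lin (φ 0) := by
    intro s
    refine eq_mul_lin_of_mul_lin_eq (ψ := φ 1) (b := b 1 s - ∑ t, C (y s t) * F t) hφ2 ?_
    have h1 := hc2 0 1 s
    have : ∑ t, c 0 1 s t * F t =
        lin (φ 1) * ∑ t, C (x s t) * F t - lin (φ 0) * ∑ t, C (y s t) * F t := by
      simp only [Finset.mul_sum, ← Finset.sum_sub_distrib]
      exact Finset.sum_congr rfl fun t _ => by rw [hxy]; ring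
    rw [this] at h1
    linear_combination h1
  choose r hr using hr
  have : g = ∑ s, r s * F s := by
    apply lin_mul_left_cancel (hφ.ne_zero 0)
    have h0 := sum_alternating_mul (fun s t => C (x s t)) (fun s t => by rw [hxa, C_neg])
      (fun s => by rw [hxd, C_0]) F
    rw [hb2, Finset.mul_sum, ← sub_zero (∑ s, b 0 s * F s), ← h0, ← Finset.sum_sub_distrib]
    exact Finset.sum_congr rfl fun s _ => by linear_combination F s * hr s
  rw [this]
  exact Ideal.sum_mem _ fun t _ => Ideal.mul_mem_left _ _ (Ideal.subset_span ⟨t, rfl⟩)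

/-- Two independent linear forms annihilating `g` and `h` modulo `F` exclude every further
linear syzygy of `g` and `h` that is independent modulo these forms. -/
lemma mem_of_two_lin_mul_mem (hK : HasKoszulSyzygies F) (hF : ∀ s, (F s).IsHomogeneous 2)
    {φ : Fin 2 → Module.Dual K (Fin n → K)} (hφ : LinearIndependent K φ)
    {g h : MvPolynomial (Fin n) K} (hg : g.IsHomogeneous 2) (hh : h.IsHomogeneous 2)
    (hφg : ∀ i, lin (φ i) * g ∈ Ideal.span (Set.range F))
    (hφh : ∀ i, lin (φ i) * h ∈ Ideal.span (Set.range F))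
    {α β : Module.Dual K (Fin n → K)}
    (hαβ : lin α * g + lin β * h ∈ Ideal.span (Set.range F))
    (hind : ∀ x y : K, x • α + y • β ∈ Submodule.span K (Set.range φ) → x = 0) :
    g ∈ Ideal.span (Set.range F) := by
  have hp : ∀ i, ∃ b : ι → MvPolynomial (Fin n) K, (∀ s, (b s).IsHomogeneous 1) ∧
      lin (φ i) * g = ∑ s, b s * F s := fun i =>
    mem_span_isHomogeneous hF ((isHomogeneous_lin _).mul hg) (hφg i)
  have hq : ∀ i, ∃ b : ι → MvPolynomial (Fin n) K, (∀ s, (b s).IsHomogeneous 1) ∧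
      lin (φ i) * h = ∑ s, b s * F s := fun i =>
    mem_span_isHomogeneous hF ((isHomogeneous_lin _).mul hh) (hφh i)
  choose p hp1 hp2 using hp
  choose q hq1 hq2 using hq
  obtain ⟨a, ha1, ha2⟩ := mem_span_isHomogeneous hF (d := 1)
    (((isHomogeneous_lin α).mul hg).add ((isHomogeneous_lin β).mul hh)) hαβ
  have hc : ∀ i, ∃ c : ι → ι → MvPolynomial (Fin n) K, (∀ s t, (c s t).IsHomogeneous 0) ∧
      (∀ s t, c s t = -c t s) ∧ (∀ s, c s s = 0) ∧
      ∀ s, lin (φ i) * a s - (lin α * p i s + lin β * q i s) = ∑ t, c s t * F t := by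
    intro i
    refine hK.exists_alternating hF (fun s => ((isHomogeneous_lin _).mul (ha1 s)).sub
      (((isHomogeneous_lin _).mul (hp1 i s)).add ((isHomogeneous_lin _).mul (hq1 i s)))) ?_
    have : ∑ s, (lin (φ i) * a s - (lin α * p i s + lin β * q i s)) * F s =
        lin (φ i) * ∑ s, a s * F s - (lin α * ∑ s, p i s * F s + lin β * ∑ s, q i s * F s) := by
      simp only [Finset.mul_sum, ← Finset.sum_sub_distrib, ← Finset.sum_add_distrib]
      exact Finset.sum_congr rfl fun s _ => by ring
    rw [this, ← ha2, ← hp2, ← hq2]; ring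
  choose c hc1 _ _ hc2 using hc
  obtain ⟨d, hd1, -, -, hd2⟩ := hK.exists_alternating hF (d := 0)
    (c := fun s => lin (φ 0) * p 1 s - lin (φ 1) * p 0 s)
    (fun s => ((isHomogeneous_lin _).mul (hp1 1 s)).sub ((isHomogeneous_lin _).mul (hp1 0 s))) (by
      have : ∑ s, (lin (φ 0) * p 1 s - lin (φ 1) * p 0 s) * F s =
          lin (φ 0) * ∑ s, p 1 s * F s - lin (φ 1) * ∑ s, p 0 s * F s := by
        simp only [Finset.mul_sum, ← Finset.sum_sub_distrib]
        exact Finset.sum_congr rfl fun s _ => by ring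
      rw [this, ← hp2, ← hp2]; ring)
  obtain ⟨e, he1, -, -, he2⟩ := hK.exists_alternating hF (d := 0)
    (c := fun s => lin (φ 0) * q 1 s - lin (φ 1) * q 0 s)
    (fun s => ((isHomogeneous_lin _).mul (hq1 1 s)).sub ((isHomogeneous_lin _).mul (hq1 0 s))) (by
      have : ∑ s, (lin (φ 0) * q 1 s - lin (φ 1) * q 0 s) * F s =
          lin (φ 0) * ∑ s, q 1 s * F s - lin (φ 1) * ∑ s, q 0 s * F s := by
        simp only [Finset.mul_sum, ← Finset.sum_sub_distrib]
        exact Finset.sum_congr rfl fun s _ => by ring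
      rw [this, ← hq2, ← hq2]; ring)
  -- Computing `lin (φ 0) * lin (φ 1) * a s` in two ways puts `d s t • α + e s t • β` (as constants)
  -- in the span of the `φ i`; `hind` then kills `d`.
  have hd3 : ∀ s t, d s t = 0 := by
    intro s t
    have h0 := hK.eq_zero hF (d := 1)
      (c := fun t => (c 1 s t * lin (φ 0) - c 0 s t * lin (φ 1)) +
        (d s t * lin α + e s t * lin β))
      (fun t => ((isHomogeneous_mul_lin (hc1 1 s t) _).sub
        (isHomogeneous_mul_lin (hc1 0 s t) _)).add
          ((isHomogeneous_mul_lin (hd1 s t) _).add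
          (isHomogeneous_mul_lin (he1 s t) _))) (by norm_num) (by
        have : ∑ t, ((c 1 s t * lin (φ 0) - c 0 s t * lin (φ 1)) +
            (d s t * lin α + e s t * lin β)) * F t =
            (lin (φ 0) * ∑ t, c 1 s t * F t - lin (φ 1) * ∑ t, c 0 s t * F t) +
              (lin α * ∑ t, d s t * F t + lin β * ∑ t, e s t * F t) := by
          simp only [Finset.mul_sum, ← Finset.sum_sub_distrib, ← Finset.sum_add_distrib]
          exact Finset.sum_congr rfl fun s _ => by ring
        rw [this, ← hc2, ← hc2, ← hd2, ← he2]; ring) t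
    obtain ⟨x, hx⟩ := exists_C_of_isHomogeneous_zero (hd1 s t)
    obtain ⟨y, hy⟩ := exists_C_of_isHomogeneous_zero (he1 s t)
    obtain ⟨z, hz⟩ := exists_C_of_isHomogeneous_zero (hc1 0 s t)
    obtain ⟨w, hw⟩ := exists_C_of_isHomogeneous_zero (hc1 1 s t)
    rw [hx, hy, hz, hw] at h0
    have hx0 : x = 0 := by
      refine hind x y ?_
      have : x • α + y • β = z • φ 1 - w • φ 0 := by
        apply lin_injective
        simp only [map_add, map_sub, map_smul, smul_eq_C_mul]
        linear_combination h0
      rw [this]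
      exact Submodule.sub_mem _ (Submodule.smul_mem _ _ (Submodule.subset_span ⟨1, rfl⟩))
        (Submodule.smul_mem _ _ (Submodule.subset_span ⟨0, rfl⟩))
    rw [hx, hx0, C_0]
  have hr : ∀ s, ∃ r, p 0 s = r * lin (φ 0) := by
    intro s
    refine eq_mul_lin_of_mul_lin_eq (ψ := φ 1) (b := p 1 s) ?_ ?_
    · convert hφ using 1
      ext i; fin_cases i <;> rfl
    · have := hd2 s
      simp only [hd3, zero_mul, Finset.sum_const_zero] at this
      linear_combination -this
  choose r hr using hr
  have : g = ∑ s, r s * F s := by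
    apply lin_mul_left_cancel (hφ.ne_zero 0)
    rw [hp2, Finset.mul_sum]
    exact Finset.sum_congr rfl fun s _ => by rw [hr]; ring
  rw [this]
  exact Ideal.sum_mem _ fun t _ => Ideal.mul_mem_left _ _ (Ideal.subset_span ⟨t, rfl⟩)

end Annihilators

/-! ### Pencils of linear maps and invariant planes. -/

section Pencils

variable {K V E Y : Type*} [Field K] [AddCommGroup V] [Module K V] [AddCommGroup E] [Module K E]
  [AddCommGroup Y] [Module K Y]

/-- The pencil of linear maps `L`, `M` has no invariant subspace of functionals of dimension at
least two. -/
def HasNoInvariantPlane (L M : V →ₗ[K] E) : Prop :=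
  ∀ C : Submodule K (Module.Dual K E), C.map L.dualMap = C.map M.dualMap → Module.finrank K C ≤ 1

/-- Take an eigenvector, and then lift an eigenvector of the map induced on the quotient by its
line. The lift need not be an eigenvector. -/
lemma exists_triangular_pair [IsAlgClosed K] (τ : V →ₗ[K] V) (h : 1 < Module.finrank K V) :
    ∃ (v w : V) (μ ν ρ : K), v ≠ 0 ∧ τ v = μ • v ∧ (∀ c : K, w ≠ c • v) ∧
      τ w - ν • w = ρ • v := by
  have : FiniteDimensional K V := Module.finite_of_finrank_pos (by omega)
  have : Nontrivial V := Module.nontrivial_of_finrank_pos (R := K) (by omega)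
  obtain ⟨μ, hμ⟩ := Module.End.exists_eigenvalue τ
  obtain ⟨v, hv⟩ := hμ.exists_hasEigenvector
  have hv1 : τ v = μ • v := hv.apply_eq_smul
  have hv0 : v ≠ 0 := hv.2
  let D : Submodule K V := Submodule.span K {v}
  have hD : D ≤ D.comap τ := by
    rw [Submodule.span_le]
    intro x hx
    rw [Set.mem_singleton_iff.1 hx]
    show τ v ∈ D
    rw [hv1]
    exact Submodule.smul_mem _ _ (Submodule.mem_span_singleton_self v)
  have hDne : D ≠ ⊤ := by
    intro h'
    have h1 : Module.finrank K D = Module.finrank K V := by rw [h']; exact finrank_top K V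
    have h2 : Module.finrank K D = 1 := finrank_span_singleton hv0
    omega
  have : Nontrivial (V ⧸ D) := Submodule.Quotient.nontrivial_iff.2 hDne
  obtain ⟨ν, hν⟩ := Module.End.exists_eigenvalue (D.mapQ D τ hD)
  obtain ⟨w', hw⟩ := hν.exists_hasEigenvector
  obtain ⟨w, rfl⟩ := Submodule.Quotient.mk_surjective D w'
  have hw1 := hw.apply_eq_smul
  rw [Submodule.mapQ_apply, ← Submodule.Quotient.mk_smul, Submodule.Quotient.eq] at hw1
  obtain ⟨ρ, hρ⟩ := Submodule.mem_span_singleton.1 hw1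
  refine ⟨v, w, μ, ν, ρ, hv0, hv1, fun c hc => hw.2 ?_, hρ.symm⟩
  rw [Submodule.Quotient.mk_eq_zero, hc]
  exact Submodule.smul_mem _ _ (Submodule.mem_span_singleton_self v)

/-- On an invariant `C` the injective map `L.dualMap` turns `M.dualMap` into an endomorphism τ. If
dim C ≥ 2, both vectors of a triangular pair for τ are sent into `Q` by `hQ`, although `Q` is at
most a line. -/
lemma hasNoInvariantPlane_of_eigenvectors [IsAlgClosed K] [FiniteDimensional K E]
    {L M : V →ₗ[K] E} (hL : Function.Surjective L) (Q : Submodule K (Module.Dual K V))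
    (hQ1 : ∀ u ∈ Q, ∀ v ∈ Q, u ≠ 0 → ∃ c : K, v = c • u)
    (hQ : ∀ (φ : Module.Dual K E) (κ : K), M.dualMap φ - κ • L.dualMap φ ∈ Q → L.dualMap φ ∈ Q) :
    HasNoInvariantPlane L M := by
  intro C hC
  by_contra hlt
  push Not at hlt
  have hinj : Function.Injective L.dualMap := LinearMap.dualMap_injective_of_surjective hL
  have ht : ∀ c : C, ∃ c' : C, L.dualMap c' = M.dualMap c := by
    intro c
    have : M.dualMap c ∈ C.map L.dualMap := by rw [hC]; exact ⟨c, c.2, rfl⟩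
    obtain ⟨c', h1, h2⟩ := this
    exact ⟨⟨c', h1⟩, h2⟩
  choose t ht using ht
  let τ : Module.End K C :=
    { toFun := t
      map_add' := fun a b => by
        apply Subtype.ext; apply hinj; rw [ht]; simp only [Submodule.coe_add, map_add, ht]
      map_smul' := fun a b => by
        apply Subtype.ext; apply hinj; rw [ht]
        simp only [Submodule.coe_smul, map_smul, ht, RingHom.id_apply] }
  have hτ : ∀ c : C, L.dualMap (τ c) = M.dualMap c := ht
  obtain ⟨v, w, μ, ν, ρ, hv0, hv1, hw0, hρ⟩ := exists_triangular_pair (V := C) τ hlt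
  have hvQ : L.dualMap v ∈ Q := by
    refine hQ v μ ?_
    rw [← hτ, hv1]; simp
  have hwQ : L.dualMap w ∈ Q := by
    refine hQ w ν ?_
    have : M.dualMap w - ν • L.dualMap w = ρ • L.dualMap v := by
      rw [← hτ, ← map_smul, ← map_sub, ← map_smul]
      congr 1
      have := congrArg Subtype.val hρ
      simpa using this
    rw [this]
    exact Q.smul_mem _ hvQ
  have hLv : L.dualMap v ≠ 0 := by
    intro h
    apply hv0
    apply Subtype.ext
    apply hinj
    rw [h]; simp
  obtain ⟨c, hc⟩ := hQ1 _ hvQ _ hwQ hLv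
  apply hw0 c
  apply Subtype.ext
  apply hinj
  rw [hc]; simp

lemma map_dualMap_dualAnnihilator (L : V →ₗ[K] E) (N : Submodule K E) :
    N.dualAnnihilator.map L.dualMap = (N.comap L).dualAnnihilator := by
  have h : N.comap L = LinearMap.ker (N.mkQ ∘ₗ L) := by
    rw [LinearMap.ker_comp, Submodule.ker_mkQ]
  rw [h, ← LinearMap.range_dualMap_eq_dualAnnihilator_ker, ← LinearMap.dualMap_comp_dualMap,
    LinearMap.range_comp, Submodule.range_dualMap_mkQ_eq]

/-- A bilinear map `X` with `X(θ)(Lθ) = 0 = X(θ)(Mθ)` has a common kernel of codimension at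
most one. -/
lemma finrank_le_finrank_iInf_ker [FiniteDimensional K E] {L M : V →ₗ[K] E}
    (hL : Function.Surjective L) (hM : Function.Surjective M) (hLM : HasNoInvariantPlane L M)
    (X : V →ₗ[K] E →ₗ[K] Y) (hXL : ∀ θ, X θ (L θ) = 0) (hXM : ∀ θ, X θ (M θ) = 0) :
    Module.finrank K E ≤ Module.finrank K (⨅ θ, LinearMap.ker (X θ) : Submodule K E) + 1 := by
  set N : Submodule K E := ⨅ θ, LinearMap.ker (X θ) with hN
  -- Polarisation gives X(θ)(Pη) = −X(η)(Pθ). So Pθ lies in the common kernel exactly when X(θ)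
  -- vanishes on the image of P, which is all of E.
  have key : ∀ {P : V →ₗ[K] E}, Function.Surjective P → (∀ θ, X θ (P θ) = 0) →
      N.comap P = LinearMap.ker X := by
    intro P hP hXP
    have hpol : ∀ θ η, X θ (P η) = - X η (P θ) := by
      intro θ η
      have := hXP (θ + η)
      simp only [map_add, LinearMap.add_apply, hXP, zero_add, add_zero] at this
      exact eq_neg_of_add_eq_zero_right this
    ext θ
    simp only [Submodule.mem_comap, hN, Submodule.mem_iInf, LinearMap.mem_ker]
    constructor
    · intro h
      ext e
      obtain ⟨η, rfl⟩ := hP e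
      rw [hpol, h, neg_zero, LinearMap.zero_apply]
    · intro h η
      rw [hpol, h, LinearMap.zero_apply, neg_zero]
  -- Both preimages of N equal ker X, so the annihilator of N is an invariant subspace and has
  -- dimension at most one.
  have h1 := hLM N.dualAnnihilator (by
    rw [map_dualMap_dualAnnihilator, map_dualMap_dualAnnihilator, key hL hXL, key hM hXM])
  have h2 := Subspace.finrank_add_finrank_dualAnnihilator_eq N
  omega

lemma exists_mem_ne_zero_of_finrank_lt {k r : ℕ} (N : Submodule K (Fin k → K))
    (h : r < Module.finrank K N) (s : Fin r → Fin k) :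
    ∃ ν ∈ N, ν ≠ 0 ∧ ∀ i, ν (s i) = 0 := by
  let f : N →ₗ[K] (Fin r → K) := (LinearMap.pi fun i => LinearMap.proj (s i)) ∘ₗ N.subtype
  have hf : LinearMap.ker f ≠ ⊥ := LinearMap.ker_ne_bot_of_finrank_lt (by simpa using h)
  obtain ⟨ν, hν, hν0⟩ := (Submodule.ne_bot_iff _).1 hf
  refine ⟨ν, ν.2, fun h => hν0 (Subtype.ext h), fun i => ?_⟩
  exact congrFun (LinearMap.mem_ker.1 hν) i

end Pencils

/-! ### Tensors annihilated by wedging with both rows. -/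

section Wedge

variable {K V : Type*} [Field K] [AddCommGroup V] [Module K V] {l m : Fin 5 → Module.Dual K V}

/-- Let X(θ)(ν) = ξ(θ) ∧ ν. Its common kernel has dimension at least four, so it contains some ν ≠ 0
with ν_a = ν_b = ν_c = 0. At an index d with ν_d ≠ 0 the relation reads ξ_abc(θ) ν_d = 0. -/
lemma eq_zero_of_wedge_three (hl : LinearIndependent K l) (hm : LinearIndependent K m)
    (hlm : HasNoInvariantPlane (LinearMap.pi l) (LinearMap.pi m))
    (ξ : Fin 5 → Fin 5 → Fin 5 → Module.Dual K V)
    (hξl : ∀ a b c d θ, ξ a b c θ * l d θ - ξ a b d θ * l c θ + ξ a c d θ * l b θ -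
      ξ b c d θ * l a θ = 0)
    (hξm : ∀ a b c d θ, ξ a b c θ * m d θ - ξ a b d θ * m c θ + ξ a c d θ * m b θ -
      ξ b c d θ * m a θ = 0) (a b c : Fin 5) : ξ a b c = 0 := by
  let X : V →ₗ[K] (Fin 5 → K) →ₗ[K] (Fin 5 × Fin 5 × Fin 5 × Fin 5 → K) :=
    LinearMap.mk₂ K (fun θ ν p => ξ p.1 p.2.1 p.2.2.1 θ * ν p.2.2.2 -
      ξ p.1 p.2.1 p.2.2.2 θ * ν p.2.2.1 + ξ p.1 p.2.2.1 p.2.2.2 θ * ν p.2.1 -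
      ξ p.2.1 p.2.2.1 p.2.2.2 θ * ν p.1)
      (fun _ _ _ => by funext p; simp only [map_add, Pi.add_apply]; ring)
      (fun _ _ _ => by funext p; simp only [map_smul, smul_eq_mul, Pi.smul_apply]; ring)
      (fun _ _ _ => by funext p; simp only [Pi.add_apply]; ring)
      (fun _ _ _ => by funext p; simp only [smul_eq_mul, Pi.smul_apply]; ring)
  have h := finrank_le_finrank_iInf_ker (pi_surjective_of_linearIndependent hl)
    (pi_surjective_of_linearIndependent hm) hlm X
    (fun θ => by funext p; exact hξl p.1 p.2.1 p.2.2.1 p.2.2.2 θ)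
    (fun θ => by funext p; exact hξm p.1 p.2.1 p.2.2.1 p.2.2.2 θ)
  simp only [Module.finrank_fin_fun] at h
  obtain ⟨ν, hν, hν0, hs⟩ := exists_mem_ne_zero_of_finrank_lt _
    (show 3 < Module.finrank K (⨅ θ, LinearMap.ker (X θ) : Submodule K (Fin 5 → K)) by omega)
    ![a, b, c]
  obtain ⟨d, hd⟩ := Function.ne_iff.1 hν0
  ext θ
  simp only [Submodule.mem_iInf, LinearMap.mem_ker] at hν
  have h1 : ξ a b c θ * ν d - ξ a b d θ * ν c + ξ a c d θ * ν b - ξ b c d θ * ν a = 0 :=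
    congrFun (hν θ) (a, b, c, d)
  have ha : ν a = 0 := hs 0
  have hb : ν b = 0 := hs 1
  have hc : ν c = 0 := hs 2
  rw [ha, hb, hc] at h1
  simpa [show ν d ≠ 0 from hd] using h1

lemma eq_zero_of_wedge_two (hl : LinearIndependent K l) (hm : LinearIndependent K m)
    (hlm : HasNoInvariantPlane (LinearMap.pi l) (LinearMap.pi m))
    (ξ : Fin 5 → Fin 5 → Module.Dual K V)
    (hξl : ∀ a b c θ, ξ a b θ * l c θ - ξ a c θ * l b θ + ξ b c θ * l a θ = 0)
    (hξm : ∀ a b c θ, ξ a b θ * m c θ - ξ a c θ * m b θ + ξ b c θ * m a θ = 0)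
    (a b : Fin 5) : ξ a b = 0 := by
  let X : V →ₗ[K] (Fin 5 → K) →ₗ[K] (Fin 5 × Fin 5 × Fin 5 → K) :=
    LinearMap.mk₂ K (fun θ ν p => ξ p.1 p.2.1 θ * ν p.2.2 -
      ξ p.1 p.2.2 θ * ν p.2.1 + ξ p.2.1 p.2.2 θ * ν p.1)
      (fun _ _ _ => by funext p; simp only [map_add, Pi.add_apply]; ring)
      (fun _ _ _ => by funext p; simp only [map_smul, smul_eq_mul, Pi.smul_apply]; ring)
      (fun _ _ _ => by funext p; simp only [Pi.add_apply]; ring)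
      (fun _ _ _ => by funext p; simp only [smul_eq_mul, Pi.smul_apply]; ring)
  have h := finrank_le_finrank_iInf_ker (pi_surjective_of_linearIndependent hl)
    (pi_surjective_of_linearIndependent hm) hlm X
    (fun θ => by funext p; exact hξl p.1 p.2.1 p.2.2 θ)
    (fun θ => by funext p; exact hξm p.1 p.2.1 p.2.2 θ)
  simp only [Module.finrank_fin_fun] at h
  obtain ⟨ν, hν, hν0, hs⟩ := exists_mem_ne_zero_of_finrank_lt _
    (show 2 < Module.finrank K (⨅ θ, LinearMap.ker (X θ) : Submodule K (Fin 5 → K)) by omega)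
    ![a, b]
  obtain ⟨c, hc⟩ := Function.ne_iff.1 hν0
  ext θ
  simp only [Submodule.mem_iInf, LinearMap.mem_ker] at hν
  have h1 : ξ a b θ * ν c - ξ a c θ * ν b + ξ b c θ * ν a = 0 :=
    congrFun (hν θ) (a, b, c)
  have ha : ν a = 0 := hs 0
  have hb : ν b = 0 := hs 1
  rw [ha, hb] at h1
  simpa [show ν c ≠ 0 from hc] using h1

end Wedge

/-! ### The 2 × 2 minors have no common factor. -/

section Minors

variable {K : Type*} [Field K] {n : ℕ}

/-- When a product is homogeneous, only the top-degree parts of its factors contribute to it. -/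
lemma exists_isHomogeneous_cofactor {σ : Type*} {a d : MvPolynomial σ K} {e : ℕ}
    (h : (a * d).IsHomogeneous e) :
    ∃ d' : MvPolynomial σ K, d'.IsHomogeneous (e - a.totalDegree) ∧
      a * d = homogeneousComponent a.totalDegree a * d' := by
  by_cases h0 : a * d = 0
  · exact ⟨0, isHomogeneous_zero _ _ _, by rw [h0, mul_zero]⟩
  have hdeg := h.totalDegree h0
  rw [totalDegree_mul_of_isDomain (left_ne_zero_of_mul h0) (right_ne_zero_of_mul h0)] at hdeg
  refine ⟨homogeneousComponent (e - a.totalDegree) d, homogeneousComponent_isHomogeneous _ _, ?_⟩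
  have h1 : homogeneousComponent e (a * d) = a * d := by
    rw [homogeneousComponent_of_mem (n := e) h, if_pos rfl]
  rw [← h1]
  conv_lhs => rw [← sum_homogeneousComponent a, Finset.sum_mul, map_sum]
  rw [Finset.sum_eq_single a.totalDegree]
  · obtain ⟨k, hk⟩ : ∃ k, e = k + a.totalDegree := ⟨e - a.totalDegree, by omega⟩
    rw [mul_comm, hk, homogeneousComponent_mul_isHomogeneous _ _
      (homogeneousComponent_isHomogeneous _ _), Nat.add_sub_cancel, mul_comm]
  · intro p hp hne
    have hp' : p < a.totalDegree := by
      have := Finset.mem_range.1 hp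
      omega
    obtain ⟨k, hk⟩ : ∃ k, e = k + p := ⟨e - p, by omega⟩
    rw [mul_comm, hk, homogeneousComponent_mul_isHomogeneous _ _
      (homogeneousComponent_isHomogeneous _ _), homogeneousComponent_eq_zero k d (by omega),
      zero_mul]
  · intro h2
    simp at h2

variable {l m : Fin 5 → Module.Dual K (Fin n → K)}

/-- The `2 × 2` minors of the matrix of linear forms with rows `l` and `m`. -/
def minor (l m : Fin 5 → Module.Dual K (Fin n → K)) (i j : Fin 5) : MvPolynomial (Fin n) K :=
  lin (l i) * lin (m j) - lin (l j) * lin (m i)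

lemma isHomogeneous_minor (i j : Fin 5) : (minor l m i j).IsHomogeneous 2 :=
  ((isHomogeneous_lin _).mul (isHomogeneous_lin _)).sub
    ((isHomogeneous_lin _).mul (isHomogeneous_lin _))

lemma exists_ne_of_three (a b c : Fin 5) : ∃ e, e ≠ a ∧ e ≠ b ∧ e ≠ c := by
  revert a b c; decide

lemma exists_ne_of_four (a b c d : Fin 5) : ∃ e, e ≠ a ∧ e ≠ b ∧ e ≠ c ∧ e ≠ d := by
  have : ({a, b, c, d} : Finset (Fin 5)).card < (Finset.univ : Finset (Fin 5)).card :=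
    lt_of_le_of_lt Finset.card_le_four (by simp)
  obtain ⟨e, -, he⟩ := Finset.exists_mem_notMem_of_card_lt_card this
  simp only [Finset.mem_insert, Finset.mem_singleton, not_or] at he
  exact ⟨e, he⟩

lemma exists_eval_eq_single {k : ℕ} {l : Fin k → Module.Dual K (Fin n → K)}
    (hl : LinearIndependent K l) (e : Fin k) :
    ∃ θ, l e θ = 1 ∧ ∀ i, i ≠ e → l i θ = 0 := by
  obtain ⟨θ, hθ⟩ := pi_surjective_of_linearIndependent hl (Pi.single e 1)
  refine ⟨θ, by simpa using congrFun hθ e, fun i hi => ?_⟩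
  have := congrFun hθ i
  rwa [Pi.single_eq_of_ne hi] at this

/-- The `2 × 2` minors have no common factor: a fraction `N / D` with every `N D_{ij}` divisible
by the minor `D` is constant. -/
lemma exists_eq_C_mul_minor (hl : LinearIndependent K l) (hm : LinearIndependent K m)
    (hlm : HasNoInvariantPlane (LinearMap.pi l) (LinearMap.pi m)) {i₀ j₀ : Fin 5}
    (h0 : minor l m i₀ j₀ ≠ 0) {N : MvPolynomial (Fin n) K} (hN : N.IsHomogeneous 2)
    (h : ∀ i j, ∃ M, M * minor l m i₀ j₀ = N * minor l m i j) :
    ∃ α : K, N = C α * minor l m i₀ j₀ := by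
  -- N / D = b / a in lowest terms; `a` then divides every minor.
  obtain ⟨a, b, c, hrel, hca, hcb⟩ :=
    UniqueFactorizationMonoid.exists_reduced_factors (minor l m i₀ j₀) h0 N
  have hc0 : c ≠ 0 := by rintro rfl; simp [h0.symm] at hca
  have hdvd : ∀ i j, ∃ d, minor l m i j = a * d := by
    intro i j
    obtain ⟨M, hM⟩ := h i j
    refine hrel.dvd_of_dvd_mul_left (z := minor l m i j) ⟨M, ?_⟩
    apply mul_left_cancel₀ hc0
    rw [← hca, ← hcb] at hM
    linear_combination -hM
  have hdvd' : ∀ i j, ∃ d : MvPolynomial (Fin n) K, d.IsHomogeneous (2 - a.totalDegree) ∧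
      minor l m i j = homogeneousComponent a.totalDegree a * d := by
    intro i j
    obtain ⟨d, hd⟩ := hdvd i j
    obtain ⟨d', h1, h2⟩ := exists_isHomogeneous_cofactor (a := a) (d := d) (e := 2)
      (hd ▸ isHomogeneous_minor i j)
    exact ⟨d', h1, hd.trans h2⟩
  choose d hd1 hd2 using hdvd'
  -- The leading form of `a` still divides every minor, now with homogeneous cofactors `d i j`, and
  -- these inherit d ∧ l = d ∧ m = 0.
  set A := homogeneousComponent a.totalDegree a with hA
  have hA0 : A ≠ 0 := by
    intro hA0
    apply h0
    rw [hd2, hA0, zero_mul]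
  have hdl : ∀ i j k, d i j * lin (l k) - d i k * lin (l j) + d j k * lin (l i) = 0 := by
    intro i j k
    apply mul_left_cancel₀ hA0
    have h1 := hd2 i j
    have h2 := hd2 i k
    have h3 := hd2 j k
    unfold minor at h1 h2 h3
    linear_combination -(lin (l k)) * h1 + lin (l j) * h2 - lin (l i) * h3
  have hdm : ∀ i j k, d i j * lin (m k) - d i k * lin (m j) + d j k * lin (m i) = 0 := by
    intro i j k
    apply mul_left_cancel₀ hA0
    have h1 := hd2 i j
    have h2 := hd2 i k
    have h3 := hd2 j k
    unfold minor at h1 h2 h3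
    linear_combination -(lin (m k)) * h1 + lin (m j) * h2 - lin (m i) * h3
  -- A constant `a` is the desired case. A linear `a` has linear cofactors, excluded by
  -- `eq_zero_of_wedge_two`. In higher degree the cofactors are constants, and d ∧ l = 0 with l
  -- independent makes them zero.
  have hcase : a.totalDegree = 0 ∨ a.totalDegree = 1 ∨ 2 ≤ a.totalDegree := by omega
  rcases hcase with hdeg | hdeg | hdeg
  · rw [totalDegree_eq_zero_iff_eq_C] at hdeg
    set x := coeff 0 a
    have hx : x ≠ 0 := by
      intro hx
      rw [hx, C_0] at hdeg
      rw [hdeg, mul_zero] at hca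
      exact h0 hca.symm
    have hN' : N = (C x⁻¹ * b) * minor l m i₀ j₀ := by
      rw [← hca, ← hcb, hdeg]
      have : (C x⁻¹ * C x : MvPolynomial (Fin n) K) = 1 := by
        rw [← C_mul, inv_mul_cancel₀ hx, C_1]
      linear_combination -c * b * this
    have h1 := homogeneousComponent_mul_isHomogeneous (C x⁻¹ * b) (minor l m i₀ j₀)
      (isHomogeneous_minor i₀ j₀) 0
    rw [← hN', homogeneousComponent_of_mem (n := 2) hN, if_pos rfl,
      homogeneousComponent_zero] at h1
    exact ⟨_, h1⟩
  · exfalso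
    rw [hdeg] at hd1
    have hξ : ∀ i j, ∃ ξ, d i j = lin ξ := fun i j => exists_lin (hd1 i j)
    choose ξ hξ using hξ
    have := eq_zero_of_wedge_two hl hm hlm ξ
      (fun i j k θ => by have := congrArg (eval θ) (hdl i j k); simpa [hξ] using this)
      (fun i j k θ => by have := congrArg (eval θ) (hdm i j k); simpa [hξ] using this) i₀ j₀
    apply h0
    rw [hd2, hξ, this, map_zero, mul_zero]
  · exfalso
    have hd0 : ∀ i j, ∃ x, d i j = C x := fun i j => exists_C_of_isHomogeneous_zero (by
      have := hd1 i j
      rwa [Nat.sub_eq_zero_of_le hdeg] at this)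
    choose x hx using hd0
    obtain ⟨e, he1, he2, -⟩ := exists_ne_of_three i₀ j₀ j₀
    obtain ⟨θ, hθ1, hθ2⟩ := exists_eval_eq_single hl e
    have h1 := congrArg (eval θ) (hdl i₀ j₀ e)
    simp only [hx, map_add, map_sub, map_mul, eval_C, eval_lin, hθ1, hθ2 i₀ he1.symm,
      hθ2 j₀ he2.symm, mul_one, mul_zero, sub_zero, add_zero, map_zero] at h1
    apply h0
    rw [hd2, hx, h1, C_0, mul_zero]

/-- If all minors vanished, m would be a nonzero multiple of l, and the whole dual space, of
dimension five, would be invariant. -/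
lemma exists_minor_ne_zero (hl : LinearIndependent K l) (hm : LinearIndependent K m)
    (hlm : HasNoInvariantPlane (LinearMap.pi l) (LinearMap.pi m)) :
    ∃ i j, minor l m i j ≠ 0 := by
  by_contra! h
  obtain ⟨r, hr⟩ := eq_mul_lin_of_mul_lin_eq (φ := l 0) (ψ := l 1) (a := lin (m 0))
    (b := lin (m 1)) (by
      convert hl.comp ![0, 1] (by decide) using 1
      ext i; fin_cases i <;> rfl) (by
      have := h 0 1
      unfold minor at this
      linear_combination -this)
  have hr0 : r.IsHomogeneous 0 := isHomogeneous_of_mul_lin (hl.ne_zero 0)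
    (by rw [← hr]; exact isHomogeneous_lin _)
  obtain ⟨κ, rfl⟩ := exists_C_of_isHomogeneous_zero hr0
  have hκ : κ ≠ 0 := by
    rintro rfl
    rw [C_0, zero_mul, lin_eq_zero] at hr
    exact hm.ne_zero 0 hr
  have hml : ∀ j, m j = κ • l j := by
    intro j
    apply lin_injective
    apply lin_mul_left_cancel (hl.ne_zero 0)
    have := h 0 j
    unfold minor at this
    rw [hr] at this
    rw [map_smul, smul_eq_C_mul]
    linear_combination this
  have := hlm ⊤ (by
    have hM : (LinearMap.pi m).dualMap = κ • (LinearMap.pi l).dualMap := by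
      refine LinearMap.ext fun φ => LinearMap.ext fun θ => ?_
      show φ (LinearMap.pi m θ) = κ • φ (LinearMap.pi l θ)
      rw [← map_smul]
      congr 1
      ext j
      simp [hml]
    rw [hM, Submodule.map_smul _ _ _ hκ])
  rw [finrank_top, Subspace.dual_finrank_eq] at this
  simp at this

/-- If all `3 × 3` minors of the matrix with rows `b`, `l`, `m` vanish, then `b` is a constant
combination of `l` and `m`. -/
lemma exists_comb_of_minors_eq_zero (hl : LinearIndependent K l) (hm : LinearIndependent K m)
    (hlm : HasNoInvariantPlane (LinearMap.pi l) (LinearMap.pi m))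
    {b : Fin 5 → MvPolynomial (Fin n) K} (hb : ∀ i, (b i).IsHomogeneous 1)
    (h : ∀ i j k, b i * minor l m j k - b j * minor l m i k + b k * minor l m i j = 0) :
    ∃ α β : K, ∀ i, b i = C α * lin (l i) + C β * lin (m i) := by
  obtain ⟨i₀, j₀, h0⟩ := exists_minor_ne_zero hl hm hlm
  have hN1 : ∀ i j, (b i * lin (m j) - b j * lin (m i)).IsHomogeneous 2 := fun i j =>
    ((hb i).mul (isHomogeneous_lin _)).sub ((hb j).mul (isHomogeneous_lin _))
  have hN2 : ∀ i j, (lin (l i) * b j - lin (l j) * b i).IsHomogeneous 2 := fun i j =>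
    ((isHomogeneous_lin _).mul (hb j)).sub ((isHomogeneous_lin _).mul (hb i))
  -- Cramer's rule: b is a combination of l and m with denominator one fixed nonzero minor; both
  -- fractions turn out to be constant.
  have hexp : ∀ k, b k * minor l m i₀ j₀ =
      (b i₀ * lin (m j₀) - b j₀ * lin (m i₀)) * lin (l k) +
        (lin (l i₀) * b j₀ - lin (l j₀) * b i₀) * lin (m k) := by
    intro k
    have := h i₀ j₀ k
    unfold minor at this ⊢
    linear_combination this
  obtain ⟨α, hα⟩ := exists_eq_C_mul_minor hl hm hlm h0 (hN1 i₀ j₀) (fun i j =>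
    ⟨b i * lin (m j) - b j * lin (m i), by
      have h1 := hexp i
      have h2 := hexp j
      rw [sub_mul]
      unfold minor at *
      linear_combination lin (m j) * h1 - lin (m i) * h2⟩)
  obtain ⟨β, hβ⟩ := exists_eq_C_mul_minor hl hm hlm h0 (hN2 i₀ j₀) (fun i j =>
    ⟨lin (l i) * b j - lin (l j) * b i, by
      have h1 := hexp i
      have h2 := hexp j
      rw [sub_mul]
      unfold minor at *
      linear_combination lin (l i) * h2 - lin (l j) * h1⟩)
  refine ⟨α, β, fun i => ?_⟩
  apply mul_right_cancel₀ h0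
  rw [hexp, hα, hβ]
  ring

end Minors

/-! ### Five syzygies in general position. -/

section LinearSyzygies

variable {K : Type*} [Field K] {n : ℕ} {ι : Type*} [Fintype ι] {F : ι → MvPolynomial (Fin n) K}
  {g h : MvPolynomial (Fin n) K}

/-- By exactness x ∧ l has constant coefficients y on F, and y ∧ l is a linear syzygy, hence zero.
Evaluating where only l_e is nonzero, for e outside {a, b, c, d}, gives y_abcd = 0; this is where
five indices are needed. -/
lemma wedge_eq_zero (hK : HasKoszulSyzygies F) (hF : ∀ s, (F s).IsHomogeneous 2)
    {l : Fin 5 → Module.Dual K (Fin n → K)} (hl : LinearIndependent K l)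
    {x : Fin 5 → Fin 5 → Fin 5 → ι → MvPolynomial (Fin n) K}
    (hx : ∀ a b c t, (x a b c t).IsHomogeneous 1)
    (h0 : ∀ a b c d, ∑ t, (x a b c t * lin (l d) - x a b d t * lin (l c) + x a c d t * lin (l b) -
      x b c d t * lin (l a)) * F t = 0) (a b c d : Fin 5) (t : ι) :
    x a b c t * lin (l d) - x a b d t * lin (l c) + x a c d t * lin (l b) -
      x b c d t * lin (l a) = 0 := by
  have hy : ∀ a b c d, ∃ y : ι → ι → MvPolynomial (Fin n) K, (∀ t u, (y t u).IsHomogeneous 0) ∧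
      (∀ s t, y s t = -y t s) ∧ (∀ s, y s s = 0) ∧
      ∀ t, x a b c t * lin (l d) - x a b d t * lin (l c) + x a c d t * lin (l b) -
        x b c d t * lin (l a) = ∑ u, y t u * F u := fun a b c d =>
    hK.exists_alternating hF (fun t => ((((hx a b c t).mul (isHomogeneous_lin _)).sub
      ((hx a b d t).mul (isHomogeneous_lin _))).add ((hx a c d t).mul (isHomogeneous_lin _))).sub
      ((hx b c d t).mul (isHomogeneous_lin _))) (h0 a b c d)
  choose y hy1 _ _ hy2 using hy
  have hy3 : ∀ a b c d t u, y a b c d t u = 0 := by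
    intro a b c d t u
    obtain ⟨e, ha, hb, hc, hd⟩ := exists_ne_of_four a b c d
    have h1 := hK.eq_zero hF (d := 1)
      (c := fun u => y a b c d t u * lin (l e) - y a b c e t u * lin (l d) +
        y a b d e t u * lin (l c) - y a c d e t u * lin (l b) + y b c d e t u * lin (l a))
      (fun u => ((((isHomogeneous_mul_lin (hy1 a b c d t u) _).sub
        (isHomogeneous_mul_lin (hy1 a b c e t u) _)).add
        (isHomogeneous_mul_lin (hy1 a b d e t u) _)).sub
        (isHomogeneous_mul_lin (hy1 a c d e t u) _)).add
        (isHomogeneous_mul_lin (hy1 b c d e t u) _)) (by norm_num) (by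
        have : ∑ u, (y a b c d t u * lin (l e) - y a b c e t u * lin (l d) +
            y a b d e t u * lin (l c) - y a c d e t u * lin (l b) +
            y b c d e t u * lin (l a)) * F u =
            lin (l e) * ∑ u, y a b c d t u * F u - lin (l d) * ∑ u, y a b c e t u * F u +
              lin (l c) * ∑ u, y a b d e t u * F u - lin (l b) * ∑ u, y a c d e t u * F u +
              lin (l a) * ∑ u, y b c d e t u * F u := by
          simp only [Finset.mul_sum, ← Finset.sum_sub_distrib, ← Finset.sum_add_distrib]
          exact Finset.sum_congr rfl fun s _ => by ring
        rw [this, ← hy2, ← hy2, ← hy2, ← hy2, ← hy2]; ring) u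
    obtain ⟨z, hz⟩ := exists_C_of_isHomogeneous_zero (hy1 a b c d t u)
    obtain ⟨θ, hθ1, hθ2⟩ := exists_eval_eq_single hl e
    have h2 := congrArg (eval θ) h1
    simp only [hz, map_add, map_sub, map_mul, eval_C, eval_lin, hθ1, hθ2 a ha.symm, hθ2 b hb.symm,
      hθ2 c hc.symm, hθ2 d hd.symm, mul_one, mul_zero, sub_zero, add_zero, map_zero] at h2
    rw [hz, h2, C_0]
  rw [hy2]
  simp [hy3]

/-- A `2 × 5` matrix of linear syzygies in general position forces `g` to vanish modulo `F`. -/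
lemma mem_of_five_syzygies (hK : HasKoszulSyzygies F) (hF : ∀ s, (F s).IsHomogeneous 2)
    (hg : g.IsHomogeneous 2) (hh : h.IsHomogeneous 2)
    {l m : Fin 5 → Module.Dual K (Fin n → K)}
    (hl : LinearIndependent K l) (hm : LinearIndependent K m)
    (hlm : HasNoInvariantPlane (LinearMap.pi l) (LinearMap.pi m))
    (hsyz : ∀ i, lin (l i) * g + lin (m i) * h ∈ Ideal.span (Set.range F)) :
    g ∈ Ideal.span (Set.range F) := by
  have hb : ∀ i, ∃ b : ι → MvPolynomial (Fin n) K, (∀ s, (b s).IsHomogeneous 1) ∧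
      lin (l i) * g + lin (m i) * h = ∑ s, b s * F s := fun i =>
    mem_span_isHomogeneous hF (((isHomogeneous_lin _).mul hg).add ((isHomogeneous_lin _).mul hh))
      (hsyz i)
  choose b hb1 hb2 using hb
  -- Wedging l g + m h = ∑ b_s F_s with l ∧ m kills the left side, so the entries of b_s ∧ l ∧ m are
  -- the coefficients of a cubic syzygy of F.
  have hx : ∀ i j k, ∃ x : ι → ι → MvPolynomial (Fin n) K, (∀ s t, (x s t).IsHomogeneous 1) ∧
      (∀ s t, x s t = -x t s) ∧ (∀ s, x s s = 0) ∧
      ∀ s, b i s * minor l m j k - b j s * minor l m i k + b k s * minor l m i j =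
        ∑ t, x s t * F t := by
    intro i j k
    refine hK.exists_alternating hF (fun s => (((hb1 i s).mul (isHomogeneous_minor j k)).sub
      ((hb1 j s).mul (isHomogeneous_minor i k))).add ((hb1 k s).mul (isHomogeneous_minor i j))) ?_
    have : ∑ s, (b i s * minor l m j k - b j s * minor l m i k + b k s * minor l m i j) * F s =
        minor l m j k * ∑ s, b i s * F s - minor l m i k * ∑ s, b j s * F s +
          minor l m i j * ∑ s, b k s * F s := by
      simp only [Finset.mul_sum, ← Finset.sum_sub_distrib, ← Finset.sum_add_distrib]
      exact Finset.sum_congr rfl fun s _ => by ring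
    rw [this, ← hb2, ← hb2, ← hb2]
    unfold minor
    ring
  choose x hx1 _ _ hx2 using hx
  have hsum : ∀ (v : Fin 5 → MvPolynomial (Fin n) K) a b c d s,
      ∑ t, (x a b c s t * v d - x a b d s t * v c + x a c d s t * v b - x b c d s t * v a) * F t =
        v d * ∑ t, x a b c s t * F t - v c * ∑ t, x a b d s t * F t +
          v b * ∑ t, x a c d s t * F t - v a * ∑ t, x b c d s t * F t := by
    intro v a b c d s
    simp only [Finset.mul_sum, ← Finset.sum_sub_distrib, ← Finset.sum_add_distrib]
    exact Finset.sum_congr rfl fun s _ => by ring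
  have hxl : ∀ s a b c d t, x a b c s t * lin (l d) - x a b d s t * lin (l c) +
      x a c d s t * lin (l b) - x b c d s t * lin (l a) = 0 := fun s =>
    wedge_eq_zero hK hF hl (x := fun a b c t => x a b c s t) (fun a b c t => hx1 a b c s t)
      (fun a b c d => by
        rw [hsum (fun i => lin (l i)), ← hx2, ← hx2, ← hx2, ← hx2]
        unfold minor
        ring)
  have hxm : ∀ s a b c d t, x a b c s t * lin (m d) - x a b d s t * lin (m c) +
      x a c d s t * lin (m b) - x b c d s t * lin (m a) = 0 := fun s =>
    wedge_eq_zero hK hF hm (x := fun a b c t => x a b c s t) (fun a b c t => hx1 a b c s t)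
      (fun a b c d => by
        rw [hsum (fun i => lin (m i)), ← hx2, ← hx2, ← hx2, ← hx2]
        unfold minor
        ring)
  have hξ : ∀ a b c s t, ∃ ξ, x a b c s t = lin ξ := fun a b c s t => exists_lin (hx1 a b c s t)
  choose ξ hξ using hξ
  have hx0 : ∀ a b c s t, x a b c s t = 0 := by
    intro a b c s t
    rw [hξ, eq_zero_of_wedge_three hl hm hlm (fun a b c => ξ a b c s t)
      (fun a b c d θ => by
        have := congrArg (eval θ) (hxl s a b c d t); simpa [hξ] using this)
      (fun a b c d θ => by
        have := congrArg (eval θ) (hxm s a b c d t); simpa [hξ] using this) a b c, map_zero]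
  have hαβ : ∀ s, ∃ α β : K, ∀ i, b i s = C α * lin (l i) + C β * lin (m i) := fun s =>
    exists_comb_of_minors_eq_zero hl hm hlm (fun i => hb1 i s) (fun i j k => by
      rw [hx2]; simp [hx0])
  choose α β hαβ using hαβ
  obtain ⟨i, j, hij⟩ := exists_minor_ne_zero hl hm hlm
  have hrel : ∀ i, lin (l i) * (g - ∑ s, C (α s) * F s) +
      lin (m i) * (h - ∑ s, C (β s) * F s) = 0 := by
    intro i
    have : ∑ s, b i s * F s = lin (l i) * ∑ s, C (α s) * F s + lin (m i) * ∑ s, C (β s) * F s := by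
      simp only [Finset.mul_sum, ← Finset.sum_add_distrib]
      exact Finset.sum_congr rfl fun s _ => by rw [hαβ]; ring
    linear_combination hb2 i + this
  have hg0 : minor l m i j * (g - ∑ s, C (α s) * F s) = 0 := by
    unfold minor
    linear_combination lin (m j) * hrel i - lin (m i) * hrel j
  have hg1 := (mul_eq_zero.1 hg0).resolve_left hij
  rw [sub_eq_zero.1 hg1]
  exact Ideal.sum_mem _ fun t _ => Ideal.mul_mem_left _ _ (Ideal.subset_span ⟨t, rfl⟩)

end LinearSyzygies

/-! ### Independent families from dimension counts. -/

section IndependentFamilies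

variable {K S M : Type*} [Field K] [AddCommGroup S] [Module K S] [AddCommGroup M] [Module K M]

lemma exists_linearIndependent_mem (N : Submodule K M) {k : ℕ} (h : k ≤ Module.finrank K N) :
    ∃ w : Fin k → M, LinearIndependent K w ∧ ∀ i, w i ∈ N := by
  obtain ⟨c, hc⟩ := exists_linearIndependent_of_le_finrank h
  exact ⟨fun i => c i, hc.map' _ (Submodule.ker_subtype N), fun i => (c i).2⟩

/-- The kernel of `T` has dimension at most a − 1, so the rank is at least b. -/
lemma exists_linearIndependent_comp [FiniteDimensional K S] (T : S →ₗ[K] M) {a b : ℕ}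
    (h : a + b ≤ Module.finrank K S + 1)
    (hker : ∀ c : Fin a → S, LinearIndependent K c → ¬ ∀ i, T (c i) = 0) :
    ∃ c : Fin b → S, LinearIndependent K fun i => T (c i) := by
  have h1 : Module.finrank K (LinearMap.ker T) < a := by
    by_contra hlt
    obtain ⟨c, hc, hc'⟩ := exists_linearIndependent_mem (LinearMap.ker T) (not_lt.1 hlt)
    exact hker c hc hc'
  have h2 := T.finrank_range_add_finrank_ker
  obtain ⟨w, hw, hw'⟩ := exists_linearIndependent_mem (LinearMap.range T) (k := b) (by omega)
  choose c hc using hw'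
  exact ⟨c, by simpa only [hc] using hw⟩

lemma linearIndependent_comp_of_injOn {k : ℕ} (T : S →ₗ[K] M) (N : Submodule K S)
    (hT : ∀ c ∈ N, T c = 0 → c = 0) {c : Fin k → S} (hc : LinearIndependent K c)
    (hcN : ∀ i, c i ∈ N) : LinearIndependent K fun i => T (c i) := by
  rw [Fintype.linearIndependent_iff] at hc ⊢
  intro x hx
  refine hc x (hT _ (Submodule.sum_mem _ fun i _ => Submodule.smul_mem _ _ (hcN i)) ?_)
  simpa using hx

/-- Here dim A ≤ 2, and (P, Q) embeds S in A × A. -/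
lemma finrank_le_four_of_mem {P Q : S →ₗ[K] M} (hPQ : ∀ c, P c = 0 → Q c = 0 → c = 0)
    (A : Submodule K M) [FiniteDimensional K A]
    (hA : ∀ w : Fin 3 → M, LinearIndependent K w → ¬ ∀ i, w i ∈ A)
    (hP : ∀ c, P c ∈ A) (hQ : ∀ c, Q c ∈ A) : Module.finrank K S ≤ 4 := by
  have h2 : Module.finrank K A < 3 := by
    by_contra hlt
    obtain ⟨w, hw, hw'⟩ := exists_linearIndependent_mem A (not_lt.1 hlt)
    exact hA w hw hw'
  let f : S →ₗ[K] A × A := (P.codRestrict A hP).prod (Q.codRestrict A hQ)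
  have hf : Function.Injective f := by
    rw [← LinearMap.ker_eq_bot, LinearMap.ker_eq_bot']
    intro c hc
    exact hPQ c (congrArg Subtype.val (congrArg Prod.fst hc))
      (congrArg Subtype.val (congrArg Prod.snd hc))
  have h1 := LinearMap.finrank_le_finrank_of_injective hf
  rw [Module.finrank_prod] at h1
  omega

end IndependentFamilies

/-! ### At most five linear syzygies over an algebraically closed field. -/

section SyzygyBound

variable {K : Type*} [Field K] {n : ℕ} {ι : Type*} [Fintype ι] {F : ι → MvPolynomial (Fin n) K}
  {g h : MvPolynomial (Fin n) K} {S : Type*} [AddCommGroup S] [Module K S]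
  {P Q : S →ₗ[K] Module.Dual K (Fin n → K)}

lemma lin_smul (κ : K) (φ : Module.Dual K (Fin n → K)) : lin (κ • φ) = C κ * lin φ := by
  rw [map_smul, smul_eq_C_mul]

/-- If `g` and `h` have at least six linear syzygies, a linear form annihilating one member of
the pencil spanned by `g` and `h` annihilates the whole pencil. -/
lemma lin_mul_mem_of_lin_mul_add_mem (hK : HasKoszulSyzygies F) (hF : ∀ s, (F s).IsHomogeneous 2)
    (hg : g.IsHomogeneous 2) (hh : h.IsHomogeneous 2) (hS : 6 ≤ Module.finrank K S)
    (hPQ : ∀ c, P c = 0 → Q c = 0 → c = 0)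
    (hsyz : ∀ c, lin (P c) * g + lin (Q c) * h ∈ Ideal.span (Set.range F)) {κ : K}
    (hκ : g + C κ * h ∉ Ideal.span (Set.range F)) {u : Module.Dual K (Fin n → K)}
    (hu : lin u * (g + C κ * h) ∈ Ideal.span (Set.range F)) :
    lin u * h ∈ Ideal.span (Set.range F) := by
  have : FiniteDimensional K S := Module.finite_of_finrank_pos (by omega)
  let T : S →ₗ[K] Module.Dual K (Fin n → K) := Q - κ • P
  -- On the kernel of Q − κP, the form P(c) kills g + κh, so this kernel has dimension at most two
  -- and the rank is at least four. The resulting four forms all kill the cubic `lin u * h`.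
  obtain ⟨c, hc⟩ := exists_linearIndependent_comp T (a := 3) (b := 4) (by omega) (by
    intro c hc hTc
    have hQ : ∀ c, T c = 0 → Q c = κ • P c := fun c hc => sub_eq_zero.1 hc
    apply hκ
    refine mem_of_three_lin_mul_mem hK hF (φ := fun i => P (c i)) ?_
      (hg.add (by simpa using (isHomogeneous_C _ κ).mul hh)) fun i => ?_
    · refine linearIndependent_comp_of_injOn P (LinearMap.ker T) (fun c hc hPc => ?_) hc hTc
      exact hPQ c hPc (by rw [hQ c hc, hPc, smul_zero])
    · have := hsyz (c i)
      rw [hQ _ (hTc i), lin_smul] at this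
      convert this using 1
      ring)
  refine mem_of_four_lin_mul_mem hK hF hc ((isHomogeneous_lin u).mul hh) fun i => ?_
  have h1 : lin (T (c i)) = lin (Q (c i)) - C κ * lin (P (c i)) := by
    rw [← lin_smul, ← map_sub]; rfl
  have h2 : lin (T (c i)) * (lin u * h) =
      lin u * (lin (P (c i)) * g + lin (Q (c i)) * h) - lin (P (c i)) * (lin u * (g + C κ * h)) := by
    rw [h1]; ring
  rw [h2]
  exact Ideal.sub_mem _ (Ideal.mul_mem_left _ _ (hsyz _)) (Ideal.mul_mem_left _ _ hu)

/-- The linear forms annihilating `g` and `h` modulo `F`. -/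
def linAnnihilator (F : ι → MvPolynomial (Fin n) K) (g h : MvPolynomial (Fin n) K) :
    Submodule K (Module.Dual K (Fin n → K)) where
  carrier := {u | lin u * g ∈ Ideal.span (Set.range F) ∧ lin u * h ∈ Ideal.span (Set.range F)}
  add_mem' := fun {a b} ha hb => by
    constructor
    · rw [map_add, add_mul]; exact Ideal.add_mem _ ha.1 hb.1
    · rw [map_add, add_mul]; exact Ideal.add_mem _ ha.2 hb.2
  zero_mem' := by constructor <;> simp
  smul_mem' := fun c a ha => by
    constructor
    · rw [lin_smul, mul_assoc]; exact Ideal.mul_mem_left _ _ ha.1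
    · rw [lin_smul, mul_assoc]; exact Ideal.mul_mem_left _ _ ha.2

/-- Two quadrics that are independent modulo a family of quadrics with only Koszul syzygies have
at most five linear syzygies modulo that family. -/
theorem finrank_lt_six_of_isAlgClosed [IsAlgClosed K] (hK : HasKoszulSyzygies F)
    (hF : ∀ s, (F s).IsHomogeneous 2) (hg : g.IsHomogeneous 2) (hh : h.IsHomogeneous 2)
    (hgh : ∀ x y : K, C x * g + C y * h ∈ Ideal.span (Set.range F) → x = 0 ∧ y = 0)
    (hPQ : ∀ c, P c = 0 → Q c = 0 → c = 0)
    (hsyz : ∀ c, lin (P c) * g + lin (Q c) * h ∈ Ideal.span (Set.range F)) :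
    Module.finrank K S < 6 := by
  by_contra! hS
  have : FiniteDimensional K S := Module.finite_of_finrank_pos (by omega)
  have hgF : g ∉ Ideal.span (Set.range F) := fun h' => by
    have := (hgh 1 0 (by simpa using h')).1
    simp at this
  have hA1 : ∀ (u : Module.Dual K (Fin n → K)) (κ : K),
      lin u * g + lin (κ • u) * h ∈ Ideal.span (Set.range F) → u ∈ linAnnihilator F g h := by
    intro u κ hu
    have hu' : lin u * (g + C κ * h) ∈ Ideal.span (Set.range F) := by
      rw [lin_smul] at hu
      convert hu using 1
      ring
    have h1 := lin_mul_mem_of_lin_mul_add_mem hK hF hg hh hS hPQ hsyz (κ := κ) (fun h' => by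
      have := (hgh 1 κ (by simpa using h')).1
      simp at this) hu'
    refine ⟨?_, h1⟩
    have : lin u * g = lin u * (g + C κ * h) - C κ * (lin u * h) := by ring
    rw [this]
    exact Ideal.sub_mem _ hu' (Ideal.mul_mem_left _ _ h1)
  have hA2 : ∀ (u : Module.Dual K (Fin n → K)) (κ : K),
      lin (κ • u) * g + lin u * h ∈ Ideal.span (Set.range F) → u ∈ linAnnihilator F g h := by
    intro u κ hu
    have hu' : lin u * (h + C κ * g) ∈ Ideal.span (Set.range F) := by
      rw [lin_smul] at hu
      convert hu using 1
      ring
    have h1 := lin_mul_mem_of_lin_mul_add_mem hK hF hh hg hS (fun c a b => hPQ c b a)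
      (fun c => by rw [add_comm]; exact hsyz c) (κ := κ) (fun h' => by
      have := (hgh κ 1 (by rw [add_comm]; simpa using h')).2
      simp at this) hu'
    refine ⟨h1, ?_⟩
    have : lin u * h = lin u * (h + C κ * g) - C κ * (lin u * g) := by ring
    rw [this]
    exact Ideal.sub_mem _ hu' (Ideal.mul_mem_left _ _ h1)
  -- Syzygies may be changed by elements of the annihilator in either component.
  have hsub : ∀ u : Module.Dual K (Fin n → K), u ∈ linAnnihilator F g h → ∀ a b,
      lin a * g + lin b * h ∈ Ideal.span (Set.range F) →
      ∀ x y : K, lin (a - x • u) * g + lin (b - y • u) * h ∈ Ideal.span (Set.range F) := by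
    intro u hu a b hab x y
    have : lin (a - x • u) * g + lin (b - y • u) * h =
        lin a * g + lin b * h - (C x * (lin u * g) + C y * (lin u * h)) := by
      rw [map_sub, map_sub, lin_smul, lin_smul]; ring
    rw [this]
    exact Ideal.sub_mem _ hab
      (Ideal.add_mem _ (Ideal.mul_mem_left _ _ hu.1) (Ideal.mul_mem_left _ _ hu.2))
  have hline : ∀ u ∈ linAnnihilator F g h, ∀ v ∈ linAnnihilator F g h, u ≠ 0 →
      ∃ c : K, v = c • u := by
    intro u hu v hv hu0
    by_contra! hne
    have hind : LinearIndependent K ![u, v] :=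
      (LinearIndependent.pair_iff' hu0).2 fun c => (hne c).symm
    -- Since the annihilator has dimension at most two, six syzygies cannot all have both components
    -- in it. Such a `w` serves as the extra syzygy for `mem_of_two_lin_mul_mem`.
    obtain ⟨w, hw⟩ : ∃ w, ¬ (P w ∈ linAnnihilator F g h ∧ Q w ∈ linAnnihilator F g h) := by
      by_contra! hall
      have h1 := finrank_le_four_of_mem hPQ (linAnnihilator F g h)
        (fun w hw hwA => hgF (mem_of_three_lin_mul_mem hK hF hw hg fun i => (hwA i).1))
        (fun c => (hall c).1) fun c => (hall c).2
      omega
    refine hgF (mem_of_two_lin_mul_mem hK hF hind hg hh ?_ ?_ (hsyz w) ?_)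
    · intro i; fin_cases i
      · exact hu.1
      · exact hv.1
    · intro i; fin_cases i
      · exact hu.2
      · exact hv.2
    · intro x y hxy
      by_contra hx
      have hz : x • P w + y • Q w ∈ linAnnihilator F g h := by
        refine (Submodule.span_le.2 ?_) hxy
        rintro _ ⟨i, rfl⟩
        fin_cases i
        · exact hu
        · exact hv
      have hz2 : P w - (-(x⁻¹ * y)) • Q w ∈ linAnnihilator F g h := by
        have := Submodule.smul_mem _ x⁻¹ hz
        rw [smul_add, smul_smul, smul_smul, inv_mul_cancel₀ hx, one_smul] at this
        have h3 : P w - (-(x⁻¹ * y)) • Q w = P w + (x⁻¹ * y) • Q w := by module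
        rwa [h3]
      have hQw : Q w ∈ linAnnihilator F g h := by
        apply hA2 (Q w) (-(x⁻¹ * y))
        have := hsub _ hz2 _ _ (hsyz w) 1 0
        simpa using this
      refine hw ⟨?_, hQw⟩
      have := Submodule.add_mem _ hz2 (Submodule.smul_mem _ (-(x⁻¹ * y)) hQw)
      rwa [sub_add_cancel] at this
  -- As the annihilator is at most a line, a single point detects its nonzero elements.
  obtain ⟨θ₀, hθ₀⟩ : ∃ θ₀ : Fin n → K, ∀ u ∈ linAnnihilator F g h, u θ₀ = 0 → u = 0 := by
    by_cases hbot : ∃ u ∈ linAnnihilator F g h, u ≠ 0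
    · obtain ⟨u, hu, hu0⟩ := hbot
      obtain ⟨θ₀, hθ₀⟩ : ∃ θ, u θ ≠ 0 := by
        by_contra! hall
        exact hu0 (LinearMap.ext hall)
      refine ⟨θ₀, fun v hv hv0 => ?_⟩
      obtain ⟨c, rfl⟩ := hline u hu v hv hu0
      have : c = 0 := by simpa [hθ₀] using hv0
      rw [this, zero_smul]
    · push Not at hbot
      exact ⟨0, fun u hu _ => hbot u hu⟩
  -- If P w = 0, then Q w is an annihilator, and conversely; the condition ψ w = 0 then makes it
  -- vanish at `θ₀`, hence be zero. So P and Q are both injective on ker ψ, which has dimension at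
  -- least five.
  let ψ : Module.Dual K S := (Module.Dual.eval K (Fin n → K) θ₀) ∘ₗ (P + Q)
  have hψ : ∀ c, ψ c = P c θ₀ + Q c θ₀ := fun c => rfl
  have hkerψ : 5 ≤ Module.finrank K (LinearMap.ker ψ) := by
    have h1 := ψ.finrank_range_add_finrank_ker
    have h2 : Module.finrank K (LinearMap.range ψ) ≤ 1 :=
      (Submodule.finrank_le _).trans (by simp)
    omega
  obtain ⟨c, hc, hcψ⟩ := exists_linearIndependent_mem (LinearMap.ker ψ) hkerψ
  have hl : LinearIndependent K fun i => P (c i) := by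
    refine linearIndependent_comp_of_injOn P (LinearMap.ker ψ) (fun w hψw hw => ?_) hc hcψ
    have hψw' : ψ w = 0 := hψw
    rw [hψ, hw] at hψw'
    have hQ : Q w ∈ linAnnihilator F g h := hA2 _ 0 (by simpa [hw] using hsyz w)
    exact hPQ _ hw (hθ₀ _ hQ (by simpa using hψw'))
  have hm : LinearIndependent K fun i => Q (c i) := by
    refine linearIndependent_comp_of_injOn Q (LinearMap.ker ψ) (fun w hψw hw => ?_) hc hcψ
    have hψw' : ψ w = 0 := hψw
    rw [hψ, hw] at hψw'
    have hP : P w ∈ linAnnihilator F g h := hA1 _ 0 (by simpa [hw] using hsyz w)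
    exact hPQ _ (hθ₀ _ hP (by simpa using hψw')) hw
  refine hgF (mem_of_five_syzygies hK hF hg hh hl hm ?_ fun i => hsyz (c i))
  refine hasNoInvariantPlane_of_eigenvectors (pi_surjective_of_linearIndependent hl)
    (linAnnihilator F g h) hline fun φ κ hφ => ?_
  have hcomb : ∀ T : S →ₗ[K] Module.Dual K (Fin n → K),
      (LinearMap.pi fun i => T (c i)).dualMap φ =
        T (∑ i, φ (Pi.single i 1) • c i) := by
    intro T
    refine LinearMap.ext fun θ => ?_
    rw [LinearMap.dualMap_apply, ← Finset.univ_sum_single (LinearMap.pi (fun i => T (c i)) θ),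
      map_sum, map_sum, LinearMap.sum_apply]
    refine Finset.sum_congr rfl fun i _ => ?_
    have : (Pi.single i (LinearMap.pi (fun i => T (c i)) θ i) : Fin 5 → K) =
        T (c i) θ • Pi.single i 1 := by
      rw [← Pi.single_smul]; simp
    rw [this, map_smul, map_smul, LinearMap.smul_apply, smul_eq_mul, smul_eq_mul, mul_comm]
  rw [hcomb, hcomb] at hφ
  rw [hcomb]
  set w := ∑ i, φ (Pi.single i 1) • c i
  -- Q w − κ P w is an annihilator, so subtracting it from the second component turns (P w, Q w)
  -- into the syzygy (P w, κ P w).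
  apply hA1 _ κ
  have := hsub _ hφ _ _ (hsyz w) 0 1
  simpa using this

end SyzygyBound

/-! ### Descent of relations from an extension field. -/

section BaseChange

variable {K L σ : Type*} [Field K] [Field L] [Algebra K L]

/-- Apply a `K`-linear functional on `L` to the coefficients of a polynomial over `L`. -/
def mapFunctional (f : L →ₗ[K] K) (p : MvPolynomial σ L) : MvPolynomial σ K :=
  ∑ u ∈ p.support, monomial u (f (coeff u p))

lemma coeff_mapFunctional (f : L →ₗ[K] K) (p : MvPolynomial σ L) (u : σ →₀ ℕ) :
    coeff u (mapFunctional f p) = f (coeff u p) := by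
  classical
  rw [mapFunctional, coeff_sum]
  simp only [coeff_monomial]
  rw [Finset.sum_ite_eq']
  split_ifs with h
  · rfl
  · rw [notMem_support_iff.1 h, map_zero]

lemma mapFunctional_sum {ι : Type*} (f : L →ₗ[K] K) (s : Finset ι) (p : ι → MvPolynomial σ L) :
    mapFunctional f (∑ i ∈ s, p i) = ∑ i ∈ s, mapFunctional f (p i) := by
  ext u
  simp only [coeff_mapFunctional, coeff_sum, map_sum]

lemma mapFunctional_mul_map (f : L →ₗ[K] K) (p : MvPolynomial σ L) (q : MvPolynomial σ K) :
    mapFunctional f (p * map (algebraMap K L) q) = mapFunctional f p * q := by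
  classical
  ext u
  simp only [coeff_mapFunctional, coeff_mul, map_sum, coeff_map]
  refine Finset.sum_congr rfl fun x _ => ?_
  rw [mul_comm, ← Algebra.smul_def, map_smul, smul_eq_mul, mul_comm]

lemma mapFunctional_C (f : L →ₗ[K] K) (a : L) :
    mapFunctional f (C a : MvPolynomial σ L) = C (f a) := by
  classical
  ext u
  rw [coeff_mapFunctional, coeff_C, coeff_C]
  split_ifs <;> simp

lemma mapFunctional_zero (f : L →ₗ[K] K) : mapFunctional f (0 : MvPolynomial σ L) = 0 := by
  simp [mapFunctional]

lemma exists_finset_eq_sum_map {κ : Type*} (B : Module.Basis κ K L) (p : MvPolynomial σ L) :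
    ∃ s₀ : Finset κ, ∀ s, s₀ ⊆ s →
      p = ∑ b ∈ s, C (B b) * map (algebraMap K L) (mapFunctional (B.coord b) p) := by
  classical
  refine ⟨p.support.biUnion fun u => (B.repr (coeff u p)).support, fun s hs => ?_⟩
  ext u
  rw [coeff_sum]
  simp only [coeff_C_mul, coeff_map, coeff_mapFunctional, Module.Basis.coord_apply]
  by_cases hu : u ∈ p.support
  · conv_lhs => rw [← B.linearCombination_repr (coeff u p), Finsupp.linearCombination_apply]
    rw [Finsupp.sum_of_support_subset (s := s)]
    · exact Finset.sum_congr rfl fun b _ => by rw [Algebra.smul_def, mul_comm]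
    · exact (Finset.subset_biUnion_of_mem (fun u => (B.repr (coeff u p)).support) hu).trans hs
    · simp
  · rw [notMem_support_iff.1 hu]
    simp

/-- Split a syzygy over `L` along a K-basis of `L`: each coordinate is a syzygy over `K`. Finitely
many basis elements occur, so the alternating matrices can be summed. -/
lemma HasKoszulSyzygies.map_algebraMap {ι : Type*} [Fintype ι] {F : ι → MvPolynomial σ K}
    (hK : HasKoszulSyzygies F) (L : Type*) [Field L] [Algebra K L] :
    HasKoszulSyzygies fun s => map (algebraMap K L) (F s) := by
  classical
  intro c hc
  let B := Module.Basis.ofVectorSpace K L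
  have h1 : ∀ b, ∑ s, mapFunctional (B.coord b) (c s) * F s = 0 := by
    intro b
    have := congrArg (mapFunctional (B.coord b)) hc
    rw [mapFunctional_sum, mapFunctional_zero] at this
    simpa only [mapFunctional_mul_map] using this
  choose a ha1 ha2 ha3 using fun b => hK _ (h1 b)
  choose s₀ hs₀ using fun s => exists_finset_eq_sum_map B (c s)
  let T := Finset.univ.biUnion s₀
  refine ⟨fun s t => ∑ b ∈ T, C (B b) * map (algebraMap K L) (a b s t), fun s t => ?_,
    fun s => ?_, fun s => ?_⟩
  · rw [← Finset.sum_neg_distrib]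
    refine Finset.sum_congr rfl fun b _ => ?_
    rw [ha1, map_neg, mul_neg]
  · exact Finset.sum_eq_zero fun b _ => by rw [ha2, map_zero, mul_zero]
  · rw [hs₀ s T (Finset.subset_biUnion_of_mem s₀ (Finset.mem_univ s))]
    simp only [Finset.sum_mul]
    rw [Finset.sum_comm]
    refine Finset.sum_congr rfl fun b _ => ?_
    rw [ha3, map_sum, Finset.mul_sum]
    exact Finset.sum_congr rfl fun t _ => by rw [map_mul, mul_assoc]

lemma eq_zero_of_forall_functional {a : L} (h : ∀ f : L →ₗ[K] K, f a = 0) : a = 0 :=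
  (Module.forall_dual_apply_eq_zero_iff K a).1 h

end BaseChange

/-! ### The syzygy bound over any field. -/

section SyzygyBoundGeneral

variable {K : Type*} [Field K] {n : ℕ} {ι : Type*} [Fintype ι] {F : ι → MvPolynomial (Fin n) K}
  {g h : MvPolynomial (Fin n) K} {S : Type*} [AddCommGroup S] [Module K S]
  {P Q : S →ₗ[K] Module.Dual K (Fin n → K)}

/-- Two quadrics that are independent modulo a family of quadrics with only Koszul syzygies have
at most five linear syzygies modulo that family, over any field. -/
theorem finrank_lt_six (hK : HasKoszulSyzygies F)
    (hF : ∀ s, (F s).IsHomogeneous 2) (hg : g.IsHomogeneous 2) (hh : h.IsHomogeneous 2)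
    (hgh : ∀ x y : K, C x * g + C y * h ∈ Ideal.span (Set.range F) → x = 0 ∧ y = 0)
    (hPQ : ∀ c, P c = 0 → Q c = 0 → c = 0)
    (hsyz : ∀ c, lin (P c) * g + lin (Q c) * h ∈ Ideal.span (Set.range F)) :
    Module.finrank K S < 6 := by
  by_contra! hS
  obtain ⟨c, hc⟩ := exists_linearIndependent_of_le_finrank hS
  let L := AlgebraicClosure K
  let m : MvPolynomial (Fin n) K →+* MvPolynomial (Fin n) L := map (algebraMap K L)
  have hp : ∀ φ : Module.Dual K (Fin n → K), ∃ φ' : Module.Dual L (Fin n → L),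
      m (lin φ) = lin φ' := fun φ => exists_lin ((isHomogeneous_lin φ).map _)
  choose e he using hp
  let P' : (Fin 6 → L) →ₗ[L] Module.Dual L (Fin n → L) :=
    Fintype.linearCombination L fun i => e (P (c i))
  let Q' : (Fin 6 → L) →ₗ[L] Module.Dual L (Fin n → L) :=
    Fintype.linearCombination L fun i => e (Q (c i))
  have hP' : ∀ x, lin (P' x) = ∑ i, C (x i) * m (lin (P (c i))) := by
    intro x
    simp only [P', Fintype.linearCombination_apply, map_sum, lin_smul, he]
  have hQ' : ∀ x, lin (Q' x) = ∑ i, C (x i) * m (lin (Q (c i))) := by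
    intro x
    simp only [Q', Fintype.linearCombination_apply, map_sum, lin_smul, he]
  -- Every functional L → K carries a relation over `L` to one over `K`; as functionals separate the
  -- elements of `L`, the six syzygies stay independent.
  have hfun : ∀ (T : S →ₗ[K] Module.Dual K (Fin n → K)) (x : Fin 6 → L) (f : L →ₗ[K] K),
      ∑ i, C (x i) * m (lin (T (c i))) = 0 → T (∑ i, f (x i) • c i) = 0 := by
    intro T x f h0
    apply lin_injective
    have := congrArg (mapFunctional f) h0
    rw [mapFunctional_sum, mapFunctional_zero] at this
    simp only [m, mapFunctional_mul_map, mapFunctional_C] at this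
    simp only [map_sum, map_smul, smul_eq_C_mul, map_zero, this]
  have hmem : ∀ p ∈ Ideal.span (Set.range F), m p ∈ Ideal.span (Set.range fun s => m (F s)) := by
    intro p hp
    have := Ideal.mem_map_of_mem m hp
    rwa [Ideal.map_span, ← Set.range_comp] at this
  have := finrank_lt_six_of_isAlgClosed (P := P') (Q := Q') (hK.map_algebraMap L)
    (fun s => (hF s).map _) (hg.map (algebraMap K L)) (hh.map (algebraMap K L)) ?_ ?_ ?_
  · simp at this
  · intro x y hxy
    have hhom : (C x * m g + C y * m h).IsHomogeneous (0 + 2) := by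
      refine IsHomogeneous.add ?_ ?_
      · exact (isHomogeneous_C _ x).mul (hg.map _)
      · exact (isHomogeneous_C _ y).mul (hh.map _)
    obtain ⟨b, hb1, hb2⟩ := mem_span_isHomogeneous (fun s => (hF s).map (algebraMap K L)) hhom hxy
    have key : ∀ f : L →ₗ[K] K, f x = 0 ∧ f y = 0 := by
      intro f
      apply hgh
      have : C (f x) * g + C (f y) * h = ∑ s, mapFunctional f (b s) * F s := by
        have h1 := congrArg (mapFunctional f) hb2
        rw [mapFunctional_sum] at h1
        have h2 : ∀ p q : MvPolynomial (Fin n) L,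
            mapFunctional f (p + q) = mapFunctional f p + mapFunctional f q := by
          intro p q
          ext u
          simp only [coeff_mapFunctional, coeff_add, map_add]
        rw [h2] at h1
        simpa only [m, mapFunctional_mul_map, mapFunctional_C] using h1
      rw [this]
      exact Ideal.sum_mem _ fun t _ => Ideal.mul_mem_left _ _ (Ideal.subset_span ⟨t, rfl⟩)
    exact ⟨eq_zero_of_forall_functional fun f => (key f).1,
      eq_zero_of_forall_functional fun f => (key f).2⟩
  · intro x hx1 hx2
    have h1 := hP' x
    have h2 := hQ' x
    rw [hx1, map_zero] at h1
    rw [hx2, map_zero] at h2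
    funext i
    refine eq_zero_of_forall_functional (K := K) fun f => ?_
    exact Fintype.linearIndependent_iff.1 hc (fun i => f (x i))
      (hPQ _ (hfun P x f h1.symm) (hfun Q x f h2.symm)) i
  · intro x
    have : lin (P' x) * m g + lin (Q' x) * m h =
        ∑ i, C (x i) * m (lin (P (c i)) * g + lin (Q (c i)) * h) := by
      rw [hP', hQ', Finset.sum_mul, Finset.sum_mul, ← Finset.sum_add_distrib]
      exact Finset.sum_congr rfl fun i _ => by rw [map_add, map_mul, map_mul]; ring
    show lin (P' x) * m g + lin (Q' x) * m h ∈ _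
    rw [this]
    exact Ideal.sum_mem _ fun i _ => Ideal.mul_mem_left _ _ (hmem _ (hsyz _))

end SyzygyBoundGeneral

/-! ### The dimensions of I_2 and I_3. -/

section Dimension

variable {K : Type*} [Field K] {n : ℕ}

instance (I : Ideal (MvPolynomial (Fin n) K)) (d : ℕ) : Module.Finite K (component I d) := by
  have : Module.Finite K (homogeneousSubmodule (Fin n) K d) :=
    Module.Finite.iff_fg.2 (homogeneousSubmodule_fg ..)
  exact Submodule.finiteDimensional_of_le (inf_le_right : component I d ≤ _)

lemma IsMinimalGenerators.linearIndependent {ι : Type*} {v : ι → MvPolynomial (Fin n) K}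
    {I : Ideal (MvPolynomial (Fin n) K)} (h : IsMinimalGenerators v I) :
    LinearIndependent K v := by
  rw [linearIndependent_iff_notMem_span]
  intro i hi
  apply h.2 i
  have hsub : (Submodule.span K (v '' (Set.univ \ {i})) : Submodule K _) ≤
      (Ideal.span (v '' {j | j ≠ i})).restrictScalars K := by
    rw [Submodule.span_le]
    rintro _ ⟨j, hj, rfl⟩
    exact Ideal.subset_span ⟨j, by simpa using hj, rfl⟩
  have hi' : v i ∈ Ideal.span (v '' {j | j ≠ i}) := hsub hi
  apply le_antisymm
  · rw [← h.1]
    exact Ideal.span_mono (Set.image_subset_range _ _)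
  · rw [← h.1, Ideal.span_le]
    rintro _ ⟨j, rfl⟩
    by_cases hj : j = i
    · rw [hj]; exact hi'
    · exact Ideal.subset_span ⟨j, hj, rfl⟩

lemma exists_C_comb_of_mem {ι : Type*} [Fintype ι] {v : ι → MvPolynomial (Fin n) K}
    (hv : ∀ i, (v i).IsHomogeneous 2) {p : MvPolynomial (Fin n) K} (hp : p.IsHomogeneous 2)
    (h : p ∈ Ideal.span (Set.range v)) : ∃ c : ι → K, p = ∑ i, c i • v i := by
  obtain ⟨b, hb1, hb2⟩ := mem_span_isHomogeneous hv (d := 0) hp h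
  choose c hc using fun i => exists_C_of_isHomogeneous_zero (hb1 i)
  exact ⟨c, by rw [hb2]; exact Finset.sum_congr rfl fun i _ => by rw [hc, smul_eq_C_mul]⟩

lemma hilbert_two {ι : Type*} [Fintype ι] {v : ι → MvPolynomial (Fin n) K}
    {I : Ideal (MvPolynomial (Fin n) K)} (h : IsMinimalGenerators v I)
    (hv : ∀ i, (v i).IsHomogeneous 2) : hilbert I 2 = Fintype.card ι := by
  have : component I 2 = Submodule.span K (Set.range v) := by
    apply le_antisymm
    · rintro p ⟨hp1, hp2⟩
      obtain ⟨c, rfl⟩ := exists_C_comb_of_mem hv hp2 (by rw [h.1]; exact hp1)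
      exact Submodule.sum_mem _ fun i _ => Submodule.smul_mem _ _ (Submodule.subset_span ⟨i, rfl⟩)
    · rw [Submodule.span_le]
      rintro _ ⟨i, rfl⟩
      exact ⟨by rw [← h.1]; exact Ideal.subset_span ⟨i, rfl⟩, hv i⟩
  rw [hilbert, this, finrank_span_eq_card h.linearIndependent]

/-- The lower bound for the number of cubics in a defect two quadratic ideal. -/
lemma le_hilbert_three {f : Fin n → MvPolynomial (Fin n) K} {g : Fin 2 → MvPolynomial (Fin n) K}
    {I : Ideal (MvPolynomial (Fin n) K)} (hf : ∀ i, (f i).IsHomogeneous 2)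
    (hg : ∀ j, (g j).IsHomogeneous 2)
    (hreg : RingTheory.Sequence.IsRegular (MvPolynomial (Fin n) K) (List.ofFn f))
    (hmin : IsMinimalGenerators (Fin.append f g) I) : n ^ 2 + 2 * n ≤ hilbert I 3 + 5 := by
  have hK := hasKoszulSyzygies_of_isWeaklyRegular f hreg.toIsWeaklyRegular
  have hli := hmin.linearIndependent
  let δ : (Fin n → K) ≃ₗ[K] Module.Dual K (Fin n → K) := (Pi.basisFun K (Fin n)).toDualEquiv
  let D := Fin (n + 2) → Fin n → K
  let Φ : D →ₗ[K] MvPolynomial (Fin n) K :=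
    ∑ i, (LinearMap.mulRight K (Fin.append f g i)) ∘ₗ lin ∘ₗ δ.toLinearMap ∘ₗ LinearMap.proj i
  have hΦ : ∀ a : D, Φ a = ∑ s, lin (δ (a (Fin.castAdd 2 s))) * f s +
      (lin (δ (a (Fin.natAdd n 0))) * g 0 + lin (δ (a (Fin.natAdd n 1))) * g 1) := by
    intro a
    simp only [Φ, LinearMap.sum_apply, LinearMap.comp_apply, LinearMap.mulRight_apply]
    rw [Fin.sum_univ_add, Fin.sum_univ_two]
    simp only [Fin.append_left, Fin.append_right]
    rfl
  have hrange : LinearMap.range Φ ≤ component I 3 := by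
    rintro _ ⟨a, rfl⟩
    simp only [Φ, LinearMap.sum_apply, LinearMap.comp_apply, LinearMap.mulRight_apply]
    refine Submodule.sum_mem _ fun i _ => ⟨?_, ?_⟩
    · exact Ideal.mul_mem_left _ _ (by rw [← hmin.1]; exact Ideal.subset_span ⟨i, rfl⟩)
    · refine (isHomogeneous_lin _).mul (n := 2) ?_
      refine Fin.addCases (fun s => ?_) (fun s => ?_) i
      · rw [Fin.append_left]; exact hf s
      · rw [Fin.append_right]; exact hg s
  -- The kernel consists of the linear syzygies of the generators. If its components at `g 0` and `g
  -- 1` vanish, what remains is a linear syzygy of f, hence zero.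
  have hker : Module.finrank K (LinearMap.ker Φ) < 6 := by
    refine finrank_lt_six (g := g 0) (h := g 1)
      (P := δ.toLinearMap ∘ₗ LinearMap.proj (Fin.natAdd n 0) ∘ₗ (LinearMap.ker Φ).subtype)
      (Q := δ.toLinearMap ∘ₗ LinearMap.proj (Fin.natAdd n 1) ∘ₗ (LinearMap.ker Φ).subtype)
      hK hf (hg 0) (hg 1) ?_ ?_ ?_
    · intro x y hxy
      have hhom : (C x * g 0 + C y * g 1).IsHomogeneous 2 :=
        IsHomogeneous.add (by simpa using (isHomogeneous_C _ x).mul (hg 0))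
          (by simpa using (isHomogeneous_C _ y).mul (hg 1))
      obtain ⟨c, hc⟩ := exists_C_comb_of_mem hf hhom hxy
      have h0 := Fintype.linearIndependent_iff.1 hli (Fin.append (fun s => -c s) ![x, y]) (by
        rw [Fin.sum_univ_add, Fin.sum_univ_two]
        simp only [Fin.append_left, Fin.append_right, neg_smul, Finset.sum_neg_distrib, ← hc]
        simp [smul_eq_C_mul])
      have hx := h0 (Fin.natAdd n 0)
      have hy := h0 (Fin.natAdd n 1)
      rw [Fin.append_right] at hx hy
      exact ⟨hx, hy⟩
    · rintro ⟨a, ha⟩ h1 h2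
      have h1' : δ (a (Fin.natAdd n 0)) = 0 := h1
      have h2' : δ (a (Fin.natAdd n 1)) = 0 := h2
      have h3 : Φ a = 0 := ha
      rw [hΦ, h1', h2'] at h3
      have h4 := hK.eq_zero hf (d := 1) (c := fun s => lin (δ (a (Fin.castAdd 2 s))))
        (fun s => isHomogeneous_lin _) (by norm_num) (by simpa using h3)
      apply Subtype.ext
      funext i
      refine Fin.addCases (fun s => ?_) (fun s => ?_) i
      · show a (Fin.castAdd 2 s) = 0
        simpa using h4 s
      · fin_cases s
        · exact (LinearEquiv.map_eq_zero_iff δ).1 h1'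
        · exact (LinearEquiv.map_eq_zero_iff δ).1 h2'
    · rintro ⟨a, ha⟩
      have h3 : Φ a = 0 := ha
      rw [hΦ] at h3
      show lin (δ (a (Fin.natAdd n 0))) * g 0 + lin (δ (a (Fin.natAdd n 1))) * g 1 ∈ _
      rw [eq_neg_of_add_eq_zero_right h3]
      exact neg_mem (Ideal.sum_mem _ fun t _ => Ideal.mul_mem_left _ _
        (Ideal.subset_span ⟨t, rfl⟩))
  have h1 := Φ.finrank_range_add_finrank_ker
  have h2 : Module.finrank K (LinearMap.range Φ) ≤ hilbert I 3 := Submodule.finrank_mono hrange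
  have h3 : Module.finrank K D = (n + 2) * n := by
    simp [D, Module.finrank_pi_fintype]
  have h4 : (n + 2) * n = n ^ 2 + 2 * n := by ring
  omega

end Dimension

/-! ### Hilbert functions of monomial ideals count monomials. -/

section MonomialIdeals

variable {K : Type*} [Field K] {n : ℕ}

lemma component_span_monomial (S : Set (Fin n →₀ ℕ)) (d : ℕ) :
    component (Ideal.span ((fun u => monomial u (1 : K)) '' S)) d =
      Submodule.span K ((fun u => monomial u (1 : K)) '' {u | u.degree = d ∧ ∃ s ∈ S, s ≤ u}) := by
  apply le_antisymm
  · rintro p ⟨hp1, hp2⟩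
    have hp1' := mem_ideal_span_monomial_image.1 hp1
    rw [← support_sum_monomial_coeff p]
    refine Submodule.sum_mem _ fun u hu => ?_
    have : monomial u (coeff u p) = coeff u p • monomial u (1 : K) := by
      rw [smul_monomial, smul_eq_mul, mul_one]
    rw [this]
    refine Submodule.smul_mem _ _ (Submodule.subset_span ⟨u, ⟨?_, hp1' u hu⟩, rfl⟩)
    by_contra hne
    exact mem_support_iff.1 hu (IsHomogeneous.coeff_eq_zero hp2 hne)
  · rw [Submodule.span_le]
    rintro _ ⟨u, ⟨hu, s, hs, hsu⟩, rfl⟩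
    refine ⟨mem_ideal_span_monomial_image.2 fun v hv => ?_, isHomogeneous_monomial _ hu⟩
    have : v = u := by
      by_contra hne
      rw [mem_support_iff, coeff_monomial, if_neg (Ne.symm hne)] at hv
      exact hv rfl
    exact ⟨s, hs, by rw [this]; exact hsu⟩

lemma hilbert_span_monomial (S : Set (Fin n →₀ ℕ)) (d : ℕ) :
    hilbert (Ideal.span ((fun u => monomial u (1 : K)) '' S)) d =
      {u : Fin n →₀ ℕ | u.degree = d ∧ ∃ s ∈ S, s ≤ u}.ncard := by
  rw [hilbert, component_span_monomial]
  set T := {u : Fin n →₀ ℕ | u.degree = d ∧ ∃ s ∈ S, s ≤ u} with hT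
  have : Fintype T := ((Finsupp.finite_of_degree_eq d).subset fun u hu => hu.1).fintype
  have hli : LinearIndependent K fun u : T => monomial (u : Fin n →₀ ℕ) (1 : K) :=
    (basisMonomials (Fin n) K).linearIndependent.comp _ Subtype.val_injective
  have himg : (fun u => monomial u (1 : K)) '' T =
      Set.range fun u : T => monomial (u : Fin n →₀ ℕ) (1 : K) := by
    rw [Set.image_eq_range]
  rw [himg, finrank_span_eq_card hli, ← Nat.card_coe_set_eq, Nat.card_eq_fintype_card]

lemma hilbert_le_ncard (I : Ideal (MvPolynomial (Fin n) K)) (d : ℕ) :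
    hilbert I d ≤ {u : Fin n →₀ ℕ | u.degree = d}.ncard := by
  have h1 : Ideal.span ((fun u => monomial u (1 : K)) '' ({0} : Set (Fin n →₀ ℕ))) = ⊤ := by
    rw [Set.image_singleton, Ideal.span_singleton_eq_top]
    exact isUnit_one
  have h2 := hilbert_span_monomial (K := K) ({0} : Set (Fin n →₀ ℕ)) d
  rw [h1] at h2
  have h3 : {u : Fin n →₀ ℕ | u.degree = d ∧ ∃ s ∈ ({0} : Set (Fin n →₀ ℕ)), s ≤ u} =
      {u | u.degree = d} := by
    ext u; simp
  rw [h3] at h2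
  rw [← h2]
  exact Submodule.finrank_mono fun p hp => ⟨trivial, hp.2⟩

end MonomialIdeals

/-! ### Lex-plus-squares ideals with prescribed degree three part. -/

section LexPlusSquares

variable {K : Type*} [Field K] {n : ℕ}

/-- Divisibility of the monomial `x^u` by `x_1^2`, `x_1 x_2` or `x_1 x_3`. -/
def IsInitial (i₀ i₁ i₂ : Fin n) (u : Fin n →₀ ℕ) : Prop :=
  2 ≤ u i₀ ∨ (1 ≤ u i₀ ∧ (1 ≤ u i₁ ∨ 1 ≤ u i₂))

lemma IsInitial.mono {i₀ i₁ i₂ : Fin n} {u v : Fin n →₀ ℕ} (h : IsInitial i₀ i₁ i₂ u)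
    (huv : u ≤ v) : IsInitial i₀ i₁ i₂ v := by
  have h0 := huv i₀
  have h1 := huv i₁
  have h2 := huv i₂
  unfold IsInitial at *
  omega

/-- Such a monomial is divisible by x_1, so raising the exponent of one of x_1, x_2, x_3 at the
first difference again gives a multiple of x_1², x_1x_2 or x_1x_3. A later first difference leaves
the condition untouched. -/
lemma IsInitial.of_toLex_lt {i₀ i₁ i₂ : Fin n} (h0 : (i₀ : ℕ) = 0) (h1 : (i₁ : ℕ) = 1)
    (h2 : (i₂ : ℕ) = 2) {u v : Fin n →₀ ℕ} (h : IsInitial i₀ i₁ i₂ u) (huv : toLex u < toLex v) :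
    IsInitial i₀ i₁ i₂ v := by
  obtain ⟨i, hlt, hi⟩ := Finsupp.Lex.lt_iff.1 huv
  have hlt' : ∀ j < i, u j = v j := hlt
  have hi' : u i < v i := hi
  unfold IsInitial at *
  rcases lt_trichotomy i i₁ with hc | hc | hc
  · have : i = i₀ := by
      apply Fin.ext
      have := Fin.lt_def.1 hc
      omega
    subst this
    omega
  · have e0 := hlt' i₀ (by rw [Fin.lt_def, hc]; omega)
    subst hc
    omega
  · have e0 := hlt' i₀ (by rw [Fin.lt_def] at *; omega)
    have e1 := hlt' i₁ hc
    by_cases hc2 : i = i₂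
    · subst hc2; omega
    · have e2 := hlt' i₂ (by
        rw [Fin.lt_def] at *
        have : (i : ℕ) ≠ i₂ := fun h => hc2 (Fin.ext h)
        omega)
      omega

/-- Monomials divisible by the square of a variable. -/
def HasSquare (u : Fin n →₀ ℕ) : Prop := ∃ i, 2 ≤ u i

lemma exists_single_of_degree_one {u : Fin n →₀ ℕ} (h : u.degree = 1) :
    ∃ j, u = Finsupp.single j 1 := by
  have hne : u ≠ 0 := by rintro rfl; simp at h
  obtain ⟨j, hj⟩ := Finsupp.ne_iff.1 hne
  have hle : Finsupp.single j 1 ≤ u := by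
    rw [Finsupp.single_le_iff]
    exact Nat.one_le_iff_ne_zero.2 hj
  obtain ⟨w, rfl⟩ := exists_add_of_le hle
  rw [map_add, Finsupp.degree_single] at h
  have : w = 0 := (Finsupp.degree_eq_zero_iff w).1 (by omega)
  exact ⟨j, by rw [this, add_zero]⟩

lemma exists_eq_add_of_le_of_degree {u w : Fin n →₀ ℕ} {d : ℕ} (h : w ≤ u)
    (hu : u.degree = w.degree + d) : ∃ z : Fin n →₀ ℕ, z.degree = d ∧ u = w + z := by
  obtain ⟨z, rfl⟩ := exists_add_of_le h
  exact ⟨z, by rw [map_add] at hu; omega, rfl⟩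

lemma single_add_single_le {i j : Fin n} (hij : i ≠ j) {u : Fin n →₀ ℕ} (hi : 1 ≤ u i)
    (hj : 1 ≤ u j) : Finsupp.single i 1 + Finsupp.single j 1 ≤ u := by
  intro k
  simp only [Finsupp.add_apply, Finsupp.single_apply]
  split_ifs with h1 h2 h2
  · exact absurd (h1.trans h2.symm) hij
  · subst h1; simpa using hi
  · subst h2; simpa using hj
  · simp

lemma ncard_degree_two {i₀ i₁ i₂ : Fin n} (h01 : i₀ ≠ i₁) (h02 : i₀ ≠ i₂) (h12 : i₁ ≠ i₂) :
    {u : Fin n →₀ ℕ | u.degree = 2 ∧ (HasSquare u ∨ IsInitial i₀ i₁ i₂ u)}.ncard = n + 2 := by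
  classical
  have hset : {u : Fin n →₀ ℕ | u.degree = 2 ∧ (HasSquare u ∨ IsInitial i₀ i₁ i₂ u)} =
      ((insert (Finsupp.single i₀ 1 + Finsupp.single i₁ 1)
        (insert (Finsupp.single i₀ 1 + Finsupp.single i₂ 1)
          (Finset.univ.image fun i => Finsupp.single i 2)) : Finset (Fin n →₀ ℕ)) : Set _) := by
    ext u
    simp only [Set.mem_ofPred_eq, Finset.coe_insert, Finset.coe_image, Finset.coe_univ,
      Set.image_univ, Set.mem_insert_iff, Set.mem_range]
    constructor
    · rintro ⟨hu, h⟩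
      have hsq : ∀ i, 2 ≤ u i → Finsupp.single i 2 = u := by
        intro i hi
        obtain ⟨z, hz, rfl⟩ := exists_eq_add_of_le_of_degree (d := 0)
          (Finsupp.single_le_iff.2 hi) (by rw [hu, Finsupp.degree_single])
        rw [(Finsupp.degree_eq_zero_iff z).1 hz, add_zero]
      have hpair : ∀ i j, i ≠ j → 1 ≤ u i → 1 ≤ u j →
          u = Finsupp.single i 1 + Finsupp.single j 1 := by
        intro i j hij hi hj
        obtain ⟨z, hz, rfl⟩ := exists_eq_add_of_le_of_degree (d := 0)
          (single_add_single_le hij hi hj) (by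
            rw [hu, map_add, Finsupp.degree_single, Finsupp.degree_single])
        rw [(Finsupp.degree_eq_zero_iff z).1 hz, add_zero]
      rcases h with ⟨i, hi⟩ | h | ⟨h, h' | h'⟩
      · exact Or.inr (Or.inr ⟨i, hsq i hi⟩)
      · exact Or.inr (Or.inr ⟨i₀, hsq i₀ h⟩)
      · exact Or.inl (hpair _ _ h01 h h')
      · exact Or.inr (Or.inl (hpair _ _ h02 h h'))
    · rintro (rfl | rfl | ⟨i, rfl⟩)
      · refine ⟨by simp, Or.inr (Or.inr ?_)⟩
        simp
      · refine ⟨by simp, Or.inr (Or.inr ?_)⟩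
        simp
      · exact ⟨by simp, Or.inl ⟨i, by simp⟩⟩
  rw [hset, Set.ncard_coe_finset, Finset.card_insert_of_notMem, Finset.card_insert_of_notMem,
    Finset.card_image_of_injective, Finset.card_univ, Fintype.card_fin]
  · exact Finsupp.single_left_injective (by norm_num)
  · intro h
    obtain ⟨i, -, hi⟩ := Finset.mem_image.1 h
    have e0 := DFunLike.congr_fun hi i₀
    have e2 := DFunLike.congr_fun hi i₂
    simp [Finsupp.single_apply, h02, h02.symm] at e0 e2
    split_ifs at e0; omega
  · intro h
    rw [Finset.mem_insert] at h
    rcases h with h | h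
    · have e1 := DFunLike.congr_fun h i₁
      simp [h01, h12.symm] at e1
    · obtain ⟨i, -, hi⟩ := Finset.mem_image.1 h
      have e0 := DFunLike.congr_fun hi i₀
      simp [Finsupp.single_apply, h01.symm] at e0
      split_ifs at e0; omega

/-- Count n² products x_i²x_j, then x_1x_2x_j with n − 2 choices of j, then x_1x_3x_j with the
remaining n − 3 choices. Only this upper bound is needed. -/
lemma ncard_degree_three_le {i₀ i₁ i₂ : Fin n} (h01 : i₀ ≠ i₁) (h02 : i₀ ≠ i₂) (h12 : i₁ ≠ i₂) :
    {u : Fin n →₀ ℕ | u.degree = 3 ∧ (HasSquare u ∨ IsInitial i₀ i₁ i₂ u)}.ncard + 5 ≤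
      n ^ 2 + 2 * n := by
  classical
  let A : Finset (Fin n →₀ ℕ) := (Finset.univ : Finset (Fin n × Fin n)).image fun p =>
    Finsupp.single p.1 2 + Finsupp.single p.2 1
  let B : Finset (Fin n →₀ ℕ) := ((Finset.univ.erase i₀).erase i₁).image fun j =>
    Finsupp.single i₀ 1 + Finsupp.single i₁ 1 + Finsupp.single j 1
  let C : Finset (Fin n →₀ ℕ) := (((Finset.univ.erase i₀).erase i₁).erase i₂).image fun j =>
    Finsupp.single i₀ 1 + Finsupp.single i₂ 1 + Finsupp.single j 1
  have hsub : {u : Fin n →₀ ℕ | u.degree = 3 ∧ (HasSquare u ∨ IsInitial i₀ i₁ i₂ u)} ⊆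
      ((A ∪ (B ∪ C) : Finset _) : Set (Fin n →₀ ℕ)) := by
    rintro u ⟨hu, h⟩
    simp only [Finset.coe_union, Set.mem_union, Finset.mem_coe]
    by_cases hsq : HasSquare u
    · left
      obtain ⟨i, hi⟩ := hsq
      obtain ⟨z, hz, rfl⟩ := exists_eq_add_of_le_of_degree (d := 1)
        (Finsupp.single_le_iff.2 hi) (by rw [hu, Finsupp.degree_single])
      obtain ⟨j, rfl⟩ := exists_single_of_degree_one hz
      exact Finset.mem_image.2 ⟨(i, j), Finset.mem_univ _, rfl⟩
    · right
      have hsq' : ∀ i, u i < 2 := fun i => by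
        by_contra hlt
        exact hsq ⟨i, not_lt.1 hlt⟩
      rcases h with h | h | ⟨h, h'⟩
      · exact absurd h hsq
      · exact absurd ⟨i₀, h⟩ hsq
      · by_cases h1 : 1 ≤ u i₁
        · left
          obtain ⟨z, hz, rfl⟩ := exists_eq_add_of_le_of_degree (d := 1)
            (single_add_single_le h01 h h1) (by
              rw [hu, map_add, Finsupp.degree_single, Finsupp.degree_single])
          obtain ⟨j, rfl⟩ := exists_single_of_degree_one hz
          refine Finset.mem_image.2 ⟨j, ?_, rfl⟩
          simp only [Finset.mem_erase, Finset.mem_univ, and_true]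
          constructor
          · rintro rfl
            have := hsq' j
            simp at this
          · rintro rfl
            have := hsq' j
            simp at this
        · right
          have h2 : 1 ≤ u i₂ := h'.resolve_left h1
          obtain ⟨z, hz, rfl⟩ := exists_eq_add_of_le_of_degree (d := 1)
            (single_add_single_le h02 h h2) (by
              rw [hu, map_add, Finsupp.degree_single, Finsupp.degree_single])
          obtain ⟨j, rfl⟩ := exists_single_of_degree_one hz
          refine Finset.mem_image.2 ⟨j, ?_, rfl⟩
          simp only [Finset.mem_erase, Finset.mem_univ, and_true]
          refine ⟨?_, ?_, ?_⟩
          · rintro rfl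
            have := hsq' j
            simp at this
          · rintro rfl
            simp at h1
          · rintro rfl
            have := hsq' j
            simp at this
  have h1 := Set.ncard_le_ncard hsub (Finset.finite_toSet _)
  rw [Set.ncard_coe_finset] at h1
  have hA : A.card ≤ n * n := by
    refine Finset.card_image_le.trans ?_
    simp
  have hE : ((Finset.univ.erase i₀).erase i₁).card = n - 2 := by
    rw [Finset.card_erase_of_mem (by simp [h01.symm]), Finset.card_erase_of_mem (by simp),
      Finset.card_univ, Fintype.card_fin]
    omega
  have hB : B.card ≤ n - 2 := Finset.card_image_le.trans hE.le
  have hC : C.card ≤ n - 3 := by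
    refine Finset.card_image_le.trans ?_
    rw [Finset.card_erase_of_mem (by simp [h02.symm, h12.symm]), hE]
    omega
  have h2 := Finset.card_union_le A (B ∪ C)
  have h3 := Finset.card_union_le B C
  have hn : 3 ≤ n := by
    have : ({i₀, i₁, i₂} : Finset (Fin n)).card = 3 := by
      rw [Finset.card_insert_of_notMem (by simp [h01, h02]),
        Finset.card_insert_of_notMem (by simp [h12]), Finset.card_singleton]
    have h4 := Finset.card_le_univ ({i₀, i₁, i₂} : Finset (Fin n))
    rw [this, Fintype.card_fin] at h4
    exact h4
  have h5 : n ^ 2 = n * n := sq n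
  omega

/-- Between an initial lex segment and the set of all monomials of degree `d` there is a lex
segment whose union with a fixed set of monomials has any prescribed intermediate size. -/
lemma exists_lexSegment_ncard {d t : ℕ} (p q : (Fin n →₀ ℕ) → Prop)
    (hp : IsLexSegment d {u | u.degree = d ∧ p u})
    (h1 : {u : Fin n →₀ ℕ | u.degree = d ∧ (q u ∨ p u)}.ncard ≤ t)
    (h2 : t ≤ {u : Fin n →₀ ℕ | u.degree = d}.ncard) :
    ∃ S : Set (Fin n →₀ ℕ), IsLexSegment d S ∧ (∀ u, u.degree = d → p u → u ∈ S) ∧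
      {u : Fin n →₀ ℕ | u.degree = d ∧ (q u ∨ u ∈ S)}.ncard = t := by
  classical
  have hfin : {u : Fin n →₀ ℕ | u.degree = d}.Finite := Finsupp.finite_of_degree_eq d
  let 𝒮 : Set (Set (Fin n →₀ ℕ)) := {S | IsLexSegment d S ∧ (∀ u, u.degree = d → p u → u ∈ S) ∧
      {u : Fin n →₀ ℕ | u.degree = d ∧ (q u ∨ u ∈ S)}.ncard ≤ t}
  have h𝒮 : 𝒮.Finite := hfin.finite_subsets.subset fun S hS u hu => hS.1.1 u hu
  -- An inclusion-maximal segment with count at most t has count exactly t: otherwise the greatest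
  -- missing monomial could be added, which keeps a lex segment and raises the count by at most one.
  obtain ⟨S, hS, hmax⟩ := h𝒮.exists_maximal 
    ⟨{u | u.degree = d ∧ p u}, hp, fun u hu hpu => ⟨hu, hpu⟩, by
    refine le_trans (le_of_eq ?_) h1
    congr 1
    ext u
    simp only [Set.mem_ofPred_eq]
    tauto⟩
  refine ⟨S, hS.1, hS.2.1, le_antisymm hS.2.2 ?_⟩
  by_contra! hlt
  have hne : ({u : Fin n →₀ ℕ | u.degree = d} \ S).Nonempty := by
    rw [Set.nonempty_iff_ne_empty]
    intro hempty
    have : {u : Fin n →₀ ℕ | u.degree = d ∧ (q u ∨ u ∈ S)} = {u | u.degree = d} := by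
      ext u
      refine ⟨fun h => h.1, fun h => ⟨h, Or.inr ?_⟩⟩
      by_contra hu
      have : u ∈ ({u : Fin n →₀ ℕ | u.degree = d} \ S) := ⟨h, hu⟩
      rw [hempty] at this
      exact this
    rw [this] at hlt
    omega
  obtain ⟨w, ⟨hw1, hw2⟩, hw3⟩ := (hfin.subset Set.sdiff_subset).exists_maximalFor
    (fun u : Fin n →₀ ℕ => toLex u) _ hne
  have hins : insert w S ∈ 𝒮 := by
    refine ⟨⟨?_, ?_⟩, fun u hu hpu => Or.inr (hS.2.1 u hu hpu), ?_⟩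
    · rintro u (rfl | hu)
      · exact hw1
      · exact hS.1.1 u hu
    · rintro u (rfl | hu) v hv huv
      · by_contra hvS
        have hv' : v ∉ S := fun h => hvS (Or.inr h)
        exact absurd (hw3 ⟨hv, hv'⟩ huv.le) (not_le.2 huv)
      · exact Or.inr (hS.1.2 u hu v hv huv)
    · have hsub : {u : Fin n →₀ ℕ | u.degree = d ∧ (q u ∨ u ∈ insert w S)} ⊆
          insert w {u : Fin n →₀ ℕ | u.degree = d ∧ (q u ∨ u ∈ S)} := by
        rintro u ⟨hu, h | rfl | h⟩
        · exact Or.inr ⟨hu, Or.inl h⟩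
        · exact Or.inl rfl
        · exact Or.inr ⟨hu, Or.inr h⟩
      have h3 := Set.ncard_le_ncard hsub ((hfin.subset fun u hu => hu.1).insert w)
      have h4 := Set.ncard_insert_le w {u : Fin n →₀ ℕ | u.degree = d ∧ (q u ∨ u ∈ S)}
      omega
  exact hw2 (hmax hins (Set.subset_insert w S) (Set.mem_insert w S))

/-- For `n ≥ 3` and every admissible value `t` there is a lex-plus-squares ideal with Hilbert
function `n + 2` in degree two and `t` in degree three. -/
lemma exists_isLexPlusPowers (hn : 3 ≤ n) {t : ℕ} (h1 : n ^ 2 + 2 * n ≤ t + 5)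
    (h2 : t ≤ {u : Fin n →₀ ℕ | u.degree = 3}.ncard) :
    ∃ L : Ideal (MvPolynomial (Fin n) K), IsLexPlusPowers (fun _ => 2) L ∧
      hilbert L 2 = n + 2 ∧ hilbert L 3 = t := by
  classical
  let i₀ : Fin n := ⟨0, by omega⟩
  let i₁ : Fin n := ⟨1, by omega⟩
  let i₂ : Fin n := ⟨2, by omega⟩
  have h01 : i₀ ≠ i₁ := by simp [i₀, i₁]
  have h02 : i₀ ≠ i₂ := by simp [i₀, i₂]
  have h12 : i₁ ≠ i₂ := by simp [i₁, i₂]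
  have hini : ∀ d, IsLexSegment d {u | u.degree = d ∧ IsInitial i₀ i₁ i₂ u} := fun d =>
    ⟨fun u hu => hu.1, fun u hu v hv huv => ⟨hv, hu.2.of_toLex_lt rfl rfl rfl huv⟩⟩
  obtain ⟨S, hS1, hS2, hS3⟩ := exists_lexSegment_ncard (d := 3) (t := t) (IsInitial i₀ i₁ i₂)
    HasSquare (hini 3) (by have := ncard_degree_three_le h01 h02 h12; omega) h2
  -- All monomials of degree at least four are included, so that the lex condition and closure under
  -- multiples only have to be checked in degrees two and three.
  let U : Set (Fin n →₀ ℕ) := {u | 4 ≤ u.degree ∨ u ∈ S ∨ (u.degree = 2 ∧ IsInitial i₀ i₁ i₂ u)}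
  have hU2 : ∀ u : Fin n →₀ ℕ, u.degree = 2 → (u ∈ U ↔ IsInitial i₀ i₁ i₂ u) := by
    intro u hu
    constructor
    · rintro (h | h | h)
      · omega
      · have := hS1.1 u h; omega
      · exact h.2
    · exact fun h => Or.inr (Or.inr ⟨hu, h⟩)
  have hU3 : ∀ u : Fin n →₀ ℕ, u.degree = 3 → (u ∈ U ↔ u ∈ S) := by
    intro u hu
    constructor
    · rintro (h | h | h)
      · omega
      · exact h
      · omega
    · exact fun h => Or.inr (Or.inl h)
  have hUle : ∀ u ∈ U, 2 ≤ u.degree := by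
    rintro u (h | h | h)
    · omega
    · have := hS1.1 u h; omega
    · exact h.1.ge
  have hUup : ∀ u ∈ U, ∀ v, u ≤ v → v ∈ U := by
    intro u hu v huv
    have hd := Finsupp.degree_mono huv
    rcases Nat.lt_or_ge 3 v.degree with h4 | h4
    · exact Or.inl h4
    rcases Nat.lt_or_ge u.degree v.degree with hlt | hge
    · have := hUle u hu
      have hu2 : u.degree = 2 := by omega
      have hv3 : v.degree = 3 := by omega
      exact (hU3 v hv3).2 (hS2 v hv3 (((hU2 u hu2).1 hu).mono huv))
    · obtain ⟨z, rfl⟩ := exists_add_of_le huv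
      rw [map_add] at hge
      have : z = 0 := (Finsupp.degree_eq_zero_iff z).1 (by omega)
      rwa [this, add_zero]
  have hUd : ∀ d, {u : Fin n →₀ ℕ | u.degree = d ∧ ∃ s ∈ U, s ≤ u} =
      {u | u.degree = d ∧ u ∈ U} := by
    intro d
    ext u
    exact ⟨fun ⟨hu, s, hs, hsu⟩ => ⟨hu, hUup s hs u hsu⟩, fun ⟨hu, h⟩ => ⟨hu, u, h, le_rfl⟩⟩
  let J : Ideal (MvPolynomial (Fin n) K) := Ideal.span ((fun u => monomial u (1 : K)) '' U)
  have hJ : IsLexIdeal J := by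
    refine ⟨⟨U, rfl⟩, fun d => ⟨{u | u.degree = d ∧ u ∈ U}, ⟨fun u hu => hu.1, ?_⟩, ?_⟩⟩
    · rintro u ⟨hu, huU⟩ v hv huv
      refine ⟨hv, ?_⟩
      rcases Nat.lt_or_ge 3 d with h4 | h4
      · exact Or.inl (by omega)
      · have := hUle u huU
        have hd : d = 2 ∨ d = 3 := by omega
        rcases hd with rfl | rfl
        · exact (hU2 v hv).2 (((hU2 u hu).1 huU).of_toLex_lt rfl rfl rfl huv)
        · exact (hU3 v hv).2 (hS1.2 u ((hU3 u hu).1 huU) v hv huv)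
    · rw [component_span_monomial, hUd]
  let G : Set (Fin n →₀ ℕ) := Set.range fun i => Finsupp.single i 2
  have hL : Ideal.span (Set.range fun i => (X i : MvPolynomial (Fin n) K) ^ 2) ⊔ J =
      Ideal.span ((fun u => monomial u (1 : K)) '' (G ∪ U)) := by
    rw [Set.image_union, Ideal.span_union]
    congr 2
    rw [← Set.range_comp]
    congr 1
    funext i
    exact X_pow_eq_monomial
  have hGU : ∀ u : Fin n →₀ ℕ, (∃ s ∈ G ∪ U, s ≤ u) ↔ HasSquare u ∨ u ∈ U := by
    intro u
    constructor
    · rintro ⟨s, ⟨i, rfl⟩ | hs, hsu⟩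
      · exact Or.inl ⟨i, Finsupp.single_le_iff.1 hsu⟩
      · exact Or.inr (hUup s hs u hsu)
    · rintro (⟨i, hi⟩ | h)
      · exact ⟨_, Or.inl ⟨i, rfl⟩, Finsupp.single_le_iff.2 hi⟩
      · exact ⟨u, Or.inr h, le_rfl⟩
  refine ⟨_, ⟨J, hJ, rfl⟩, ?_, ?_⟩
  · rw [hL, hilbert_span_monomial, ← ncard_degree_two h01 h02 h12]
    congr 1
    ext u
    simp only [Set.mem_ofPred_eq, hGU]
    exact and_congr_right fun hu => or_congr_right (hU2 u hu)
  · rw [hL, hilbert_span_monomial, ← hS3]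
    congr 1
    ext u
    simp only [Set.mem_ofPred_eq, hGU]
    exact and_congr_right fun hu => or_congr_right (hU3 u hu)

end LexPlusSquares

end EGH

end

theorem mainTheorem2 {K : Type*} [Field K] (n : ℕ) (hn : 5 ≤ n)
    (I : Ideal (MvPolynomial (Fin n) K)) (hI : EGH.IsDefectQuadraticIdeal 2 I) :
    (n : ℤ) ^ 2 + 2 * (n : ℤ) - 5 ≤ (EGH.hilbert I 3 : ℤ) ∧
      EGH.HoldsFor (fun _ : Fin n => 2) 2 I := by
  obtain ⟨f, g, hf, hg, hreg, hmin⟩ := hI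
  have h3 := EGH.le_hilbert_three hf hg hreg hmin
  have h2 : EGH.hilbert I 2 = n + 2 := by
    rw [EGH.hilbert_two hmin fun i => ?_, Fintype.card_fin]
    refine Fin.addCases (fun s => ?_) (fun s => ?_) i
    · rw [Fin.append_left]; exact hf s
    · rw [Fin.append_right]; exact hg s
  refine ⟨by zify at h3; linarith, ?_⟩
  obtain ⟨L, hL, hL2, hL3⟩ := EGH.exists_isLexPlusPowers (K := K) (by omega) h3
    (EGH.hilbert_le_ncard I 3)
  exact ⟨L, hL, by rw [h2, hL2], hL3.symm⟩
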